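/- Let $b,c$ be positive integers, let $x_1,x_2$ be independent variables, and define $x_m\in\mathbb{Q}(x_1,x_2)$ for $m\in\mathbb{Z}$ by the relations $x_{m-1}x_{m+1}=x_m^b+1$ for $m$ odd and $x_{m-1}x_{m+1}=x_m^c+1$ for $m$ even. Let $\mathcal{A}=\mathcal{A}(b,c)$ be the subring of $\mathbb{Q}(x_1,x_2)$ generated by all $x_m$, $m\in\mathbb{Z}$. Let $(a_1,a_2)\in\mathbb{Z}^2$. An element $x\in\mathcal{A}$ is called greedy at $(a_1,a_2)$ if it has the form $$x=x_1^{-a_1}x_2^{-a_2}\sum_{p,q\ge 0}c(p,q)\,x_1^{bp}x_2^{cq}$$ with $c(p,q)\in\mathbb{Z}$, only finitely many of them nonzero, $c(0,0)=1$, and $$c(p,q)=\max\left(\sum_{k=1}^{p}(-1)^{k-1}c(p-k,q)\binom{a_2-cq+k-1}{k},\ \sum_{k=1}^{q}(-1)^{k-1}c(p,q-k)\binom{a_1-bp+k-1}{k}\right)$$ for every nonzero pair $(p,q)\in\mathbb{Z}_{\ge 0}^2$, where $\binom{n}{k}$ is taken to be $0$ unless $0\le k\le n$, and an empty sum is $0$.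 Then for every $(a_1,a_2)\in\mathbb{Z}^2$ there is exactly one element of $\mathcal{A}$ that is greedy at $(a_1,a_2)$; denote it by $x[a_1,a_2]$, and call the set of all $x[a_1,a_2]$, $(a_1,a_2)\in\mathbb{Z}^2$, the greedy basis. For every $p\in\mathbb{Z}$ there is a (unique) ring automorphism $\sigma_p$ of $\mathcal{A}$ such that $\sigma_p(x_m)=x_{2p-m}$ for all $m\in\mathbb{Z}$; it is an involution, and it maps the greedy basis onto itself. Specifically, $$\sigma_1(x[a_1,a_2])=x[a_1,\,c[a_1]_+-a_2],\qquad \sigma_2(x[a_1,a_2])=x[b[a_2]_+-a_1,\,a_2]$$ for all $(a_1,a_2)\in\mathbb{Z}^2$, where $[a]_+=\max(a,0)$. -/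

import Mathlib

namespace RankTwo

noncomputable section

/-- The ambient field `ℚ(x₁, x₂)` of rational functions in two independent variables. -/
abbrev Ambient : Type := FractionRing (MvPolynomial (Fin 2) ℚ)

/-- The initial variable `x₁`. -/
def x₁ : Ambient := algebraMap (MvPolynomial (Fin 2) ℚ) Ambient (MvPolynomial.X 0)

/-- The initial variable `x₂`. -/
def x₂ : Ambient := algebraMap (MvPolynomial (Fin 2) ℚ) Ambient (MvPolynomial.X 1)

/-- The exponent in the exchange relation for `x_{m-1} x_{m+1}`: it is `b` for odd `m` and
`c` for even `m`. -/
def exchangeExp (b c : ℕ) (m : ℤ) : ℕ := if Odd m then b else c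

/-- `forward b c n = (x_{n+1}, x_{n+2})`, computed from `(x₁, x₂)` by the exchange relations. -/
def forward (b c : ℕ) : ℕ → Ambient × Ambient
  | 0 => (x₁, x₂)
  | n + 1 =>
    ((forward b c n).2,
      ((forward b c n).2 ^ exchangeExp b c ((n : ℤ) + 2) + 1) / (forward b c n).1)

/-- `backward b c n = (x_{2-n}, x_{1-n})`, computed from `(x₂, x₁)` by the exchange relations. -/
def backward (b c : ℕ) : ℕ → Ambient × Ambient
  | 0 => (x₂, x₁)
  | n + 1 =>
    ((backward b c n).2,
      ((backward b c n).2 ^ exchangeExp b c (1 - (n : ℤ)) + 1) / (backward b c n).1)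

/-- The cluster variable `x_m`, for `m ∈ ℤ`. -/
def clusterVar (b c : ℕ) (m : ℤ) : Ambient :=
  if 1 ≤ m then (forward b c (m - 1).toNat).1 else (backward b c (1 - m).toNat).2

/-- The rational functions `f / g` with `f` and `g` positive at `(1, 1)`; none of them is zero. -/
def PosAtOne (z : Ambient) : Prop :=
  ∃ f g : MvPolynomial (Fin 2) ℚ,
    0 < MvPolynomial.eval (fun _ => (1 : ℚ)) f ∧ 0 < MvPolynomial.eval (fun _ => (1 : ℚ)) g ∧
      z = algebraMap _ Ambient f / algebraMap _ Ambient g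

theorem algebraMap_ne_zero_of_pos {f : MvPolynomial (Fin 2) ℚ}
    (hf : 0 < MvPolynomial.eval (fun _ => (1 : ℚ)) f) : algebraMap _ Ambient f ≠ 0 := by
  intro h
  have h0 : f = 0 := by
    apply IsFractionRing.injective (MvPolynomial (Fin 2) ℚ) Ambient
    rw [h, map_zero]
  rw [h0, map_zero] at hf
  exact lt_irrefl _ hf

theorem PosAtOne.ne_zero {z : Ambient} (hz : PosAtOne z) : z ≠ 0 := by
  obtain ⟨f, g, hf, hg, rfl⟩ := hz
  exact div_ne_zero (algebraMap_ne_zero_of_pos hf) (algebraMap_ne_zero_of_pos hg)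

theorem PosAtOne.exchange {u v : Ambient} (hu : PosAtOne u) (hv : PosAtOne v) (e : ℕ) :
    PosAtOne ((v ^ e + 1) / u) := by
  obtain ⟨f, g, hf, hg, rfl⟩ := hu
  obtain ⟨f', g', hf', hg', rfl⟩ := hv
  have h1 := algebraMap_ne_zero_of_pos hf
  have h2 := algebraMap_ne_zero_of_pos hg
  have h3 := algebraMap_ne_zero_of_pos hg'
  refine ⟨(f' ^ e + g' ^ e) * g, g' ^ e * f, ?_, ?_, ?_⟩
  · simp only [map_mul, map_add, map_pow]
    positivity
  · simp only [map_mul, map_pow]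
    positivity
  · simp only [map_mul, map_add, map_pow, div_pow]
    field_simp

theorem posAtOne_x₁ : PosAtOne x₁ := ⟨MvPolynomial.X 0, 1, by simp, by simp, by simp [x₁]⟩

theorem posAtOne_x₂ : PosAtOne x₂ := ⟨MvPolynomial.X 1, 1, by simp, by simp, by simp [x₂]⟩

theorem posAtOne_forward (b c n : ℕ) :
    PosAtOne (forward b c n).1 ∧ PosAtOne (forward b c n).2 := by
  induction n with
  | zero => exact ⟨posAtOne_x₁, posAtOne_x₂⟩
  | succ n ih => exact ⟨ih.2, ih.1.exchange ih.2 _⟩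

theorem posAtOne_backward (b c n : ℕ) :
    PosAtOne (backward b c n).1 ∧ PosAtOne (backward b c n).2 := by
  induction n with
  | zero => exact ⟨posAtOne_x₂, posAtOne_x₁⟩
  | succ n ih => exact ⟨ih.2, ih.1.exchange ih.2 _⟩

theorem clusterVar_one (b c : ℕ) : clusterVar b c 1 = x₁ := by
  simp [clusterVar, forward]

theorem clusterVar_two (b c : ℕ) : clusterVar b c 2 = x₂ := by
  simp [clusterVar, forward]

theorem forward_fst (b c n : ℕ) : (forward b c n).1 = clusterVar b c ((n : ℤ) + 1) := by
  rw [clusterVar, if_pos (by omega)]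
  congr 2
  omega

theorem backward_snd (b c n : ℕ) : (backward b c n).2 = clusterVar b c (1 - (n : ℤ)) := by
  rcases n with _ | n
  · simp [clusterVar, forward, backward]
  · rw [clusterVar, if_neg (by push_cast; omega)]
    congr 2
    omega

theorem backward_fst (b c n : ℕ) : (backward b c n).1 = clusterVar b c (2 - (n : ℤ)) := by
  rcases n with _ | n
  · simp [clusterVar_two, backward]
  · have h := backward_snd b c n
    rw [show (2 : ℤ) - ((n + 1 : ℕ) : ℤ) = 1 - (n : ℤ) by push_cast; ring, ← h, backward]

/-- The exchange relations; together with `clusterVar_one` and `clusterVar_two` they determine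
all the `x_m`. -/
theorem exchange_relation (b c : ℕ) (m : ℤ) :
    clusterVar b c (m - 1) * clusterVar b c (m + 1) =
      clusterVar b c m ^ (if Odd m then b else c) + 1 := by
  rcases le_or_gt 2 m with hm | hm
  · obtain ⟨n, rfl⟩ : ∃ n : ℕ, m = (n : ℤ) + 2 := ⟨(m - 2).toNat, by omega⟩
    have h1 := forward_fst b c n
    have h2 := forward_fst b c (n + 1)
    have h3 := forward_fst b c (n + 2)
    push_cast at h2 h3
    rw [show (n : ℤ) + 2 - 1 = n + 1 by ring, ← h1, ← h3,
      show (n : ℤ) + 2 = n + 1 + 1 by ring, ← h2]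
    change (forward b c n).1 *
      (((forward b c n).2 ^ exchangeExp b c ((n : ℤ) + 2) + 1) / (forward b c n).1) =
        (forward b c n).2 ^ _ + 1
    rw [mul_div_cancel₀ _ (posAtOne_forward b c n).1.ne_zero, exchangeExp,
      show (n : ℤ) + 2 = n + 1 + 1 by ring]
  · obtain ⟨n, rfl⟩ : ∃ n : ℕ, m = 1 - (n : ℤ) := ⟨(1 - m).toNat, by omega⟩
    have h1 := backward_fst b c n
    have h2 := backward_snd b c n
    have h3 := backward_snd b c (n + 1)
    push_cast at h3
    rw [show 1 - (n : ℤ) + 1 = 2 - n by ring, show 1 - (n : ℤ) - 1 = 1 - (n + 1) by ring,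
      ← h1, ← h2, ← h3]
    change (((backward b c n).2 ^ exchangeExp b c (1 - (n : ℤ)) + 1) / (backward b c n).1) *
      (backward b c n).1 = (backward b c n).2 ^ _ + 1
    rw [div_mul_cancel₀ _ (posAtOne_backward b c n).1.ne_zero, exchangeExp]

/-- The cluster algebra `𝒜(b, c)`: the subring of `ℚ(x₁, x₂)` generated by all cluster
variables. -/
def clusterAlgebra (b c : ℕ) : Subring Ambient :=
  Subring.closure (Set.range (clusterVar b c))

/-- The cluster variable `x_m` as an element of the cluster algebra. -/
def clusterGen (b c : ℕ) (m : ℤ) : clusterAlgebra b c :=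
  ⟨clusterVar b c m, Subring.subset_closure ⟨m, rfl⟩⟩

/-- The binomial coefficient `binom(n, k)` with an integer `n`, under the convention that it is
zero unless `0 ≤ k ≤ n`. -/
def binom (n : ℤ) (k : ℕ) : ℤ := if (k : ℤ) ≤ n then (n.toNat.choose k : ℤ) else 0

/-- The Laurent polynomial
`x₁ ^ (-a₁) * x₂ ^ (-a₂) * ∑_{p, q ≥ 0} coef (p, q) * x₁ ^ (b p) * x₂ ^ (c q)`. -/
def pointedSum (b c : ℕ) (a₁ a₂ : ℤ) (coef : ℕ × ℕ →₀ ℤ) : Ambient :=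
  x₁ ^ (-a₁) * x₂ ^ (-a₂) *
    coef.sum fun pq n => (n : Ambient) * x₁ ^ (b * pq.1) * x₂ ^ (c * pq.2)

/-- `z` is pointed at `(a₁, a₂)`, with coefficients `coef` in its expansion. -/
def IsPointedWith (b c : ℕ) (a₁ a₂ : ℤ) (coef : ℕ × ℕ →₀ ℤ) (z : clusterAlgebra b c) : Prop :=
  coef (0, 0) = 1 ∧ (z : Ambient) = pointedSum b c a₁ a₂ coef

/-- The recurrence relation for the coefficients of a greedy element at `(a₁, a₂)`. -/
def GreedyRecurrence (b c : ℕ) (a₁ a₂ : ℤ) (coef : ℕ × ℕ → ℤ) : Prop :=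
  ∀ p q : ℕ, (p, q) ≠ (0, 0) →
    coef (p, q) = max
      (∑ k ∈ Finset.Icc 1 p,
        (-1) ^ (k - 1) * coef (p - k, q) * binom (a₂ - (c : ℤ) * q + k - 1) k)
      (∑ k ∈ Finset.Icc 1 q,
        (-1) ^ (k - 1) * coef (p, q - k) * binom (a₁ - (b : ℤ) * p + k - 1) k)

/-- The element `z` of the cluster algebra is greedy at `(a₁, a₂)`. -/
def IsGreedyAt (b c : ℕ) (a₁ a₂ : ℤ) (z : clusterAlgebra b c) : Prop :=
  ∃ coef : ℕ × ℕ →₀ ℤ, IsPointedWith b c a₁ a₂ coef z ∧ GreedyRecurrence b c a₁ a₂ coef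

/-- The element `x[a₁, a₂]`: the element greedy at `(a₁, a₂)`. It is picked by choice, so it means
what it should where such an element exists and is unique. -/
def greedyElement (b c : ℕ) (a₁ a₂ : ℤ) : clusterAlgebra b c :=
  Classical.epsilon (IsGreedyAt b c a₁ a₂)

/-- The greedy basis: the set of all greedy elements of the cluster algebra. -/
def greedyBasis (b c : ℕ) : Set (clusterAlgebra b c) :=
  {z | ∃ a₁ a₂ : ℤ, IsGreedyAt b c a₁ a₂ z}

end

end RankTwo

/-! Collect the coefficients `c(p,q)` in a polynomial `G` in `X = x₁^b` and `Y = x₂^c`. The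
binomials in the recurrence are the coefficients of negative powers of `1 + X`: if row `q` of `G` is
`(1 + X)^[a₂ - cq]₊ D_q`, the first sum at `(p, q)` is `c(p,q)` minus the `p`-th coefficient of
`D_q`. In the same way the second sum is governed by the quotient `E_p` of column `p`. So the
recurrence holds as soon as all quotients have nonnegative coefficients (`IsPositive`) and, at every
nonzero point, one of the two quotient coefficients vanishes. `IsRegional` prescribes which: `D`
vanishes where `cq a₁ ≤ bp a₂`, and `E` on the opposite closed side. The region conditions alone,
without positivity, already determine `G` (`IsRegional.unique`).

Existence: if `a₁ ≤ 0` or `a₂ ≤ 0`, `G` is a power of `1 + X` or of `1 + Y`. Otherwise `G` counts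
compatible pairs `(S, S')` on a balanced circular word with `a₁` letters in `H` and `a₂` outside.
Exactly `[a₂ - c|S|]₊` letters outside `H` escape the shadow of `S`, and they may be put into `S'`
or left out freely, which gives the power of `1 + X` with a positive quotient (`coeff_compatPoly`).
A potential argument places all remaining pairs strictly on one side of the diagonal
(`Compat.mul_card_lt`). Reading the word backwards gives the columns. Divisibility of rows and
columns puts the element in the cluster algebra (`laurent_mem`).

Symmetry: `σ₁` fixes `x₁` and sends `x₂` to `x₀ = (1 + x₁^b)/x₂`. For `a₁, a₂ > 0` it reverses the
order of the rows and keeps their quotients, so the row conditions at the reflected point become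
inequalities about the old regions. The image lies in the cluster algebra, so its columns are
divisible as well, by the Laurent phenomenon (`rowDvd_of_mem`, `colDvd_of_mem`). Hence it is
regional (`IsRegional.reflect`), and uniqueness identifies it with the greedy element there.
Exchanging `x₁` and `x₂` turns this into the statement for `σ₂`, and these two generate all the
`σ_p`. -/

namespace RankTwo

/-! ### Partial sums of functions on the integers -/

/-- A discrete primitive of `f : ℤ → ℤ`, vanishing at `0`. -/
def cum (f : ℤ → ℤ) (k : ℤ) : ℤ :=
  if 0 ≤ k then ∑ i ∈ Finset.range k.toNat, f i
  else -∑ i ∈ Finset.range (-k).toNat, f (-1 - (i : ℤ))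

theorem cum_zero (f : ℤ → ℤ) : cum f 0 = 0 := by simp [cum]

theorem cum_succ (f : ℤ → ℤ) (k : ℤ) : cum f (k + 1) = cum f k + f k := by
  rcases le_or_gt 0 k with hk | hk
  · obtain ⟨n, rfl⟩ := Int.eq_ofNat_of_zero_le hk
    rw [cum, cum, if_pos (by omega), if_pos hk, show ((n : ℤ) + 1).toNat = n + 1 by omega,
      Finset.sum_range_succ, show ((n : ℤ)).toNat = n by omega]
  · obtain ⟨n, rfl⟩ : ∃ n : ℕ, k = -1 - (n : ℤ) := ⟨(-1 - k).toNat, by omega⟩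
    have h : cum f (-1 - (n : ℤ)) = -∑ i ∈ Finset.range (n + 1), f (-1 - (i : ℤ)) := by
      rw [cum, if_neg (by omega), show (-(-1 - (n : ℤ))).toNat = n + 1 by omega]
    have h' : cum f (-1 - (n : ℤ) + 1) = -∑ i ∈ Finset.range n, f (-1 - (i : ℤ)) := by
      rcases Nat.eq_zero_or_pos n with rfl | hn
      · simp [cum]
      · rw [cum, if_neg (by omega), show (-(-1 - (n : ℤ) + 1)).toNat = n by omega]
    rw [h, h', Finset.sum_range_succ]
    ring

/-- A function on the integers with the increments of `cum f` differs from it by a constant. -/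
theorem cum_unique {f : ℤ → ℤ} {F : ℤ → ℤ} (hF : ∀ k, F (k + 1) = F k + f k) (k : ℤ) :
    F k = F 0 + cum f k := by
  induction k using Int.induction_on with
  | zero => simp [cum_zero]
  | succ i ih => rw [hF, cum_succ, ih]; ring
  | pred i ih =>
    have h1 := hF (-(i : ℤ) - 1)
    have h2 := cum_succ f (-(i : ℤ) - 1)
    rw [sub_add_cancel] at h1 h2
    linarith

theorem cum_add_period {f : ℤ → ℤ} {n : ℤ} (hf : ∀ j, f (j + n) = f j) (k : ℤ) :
    cum f (k + n) = cum f k + cum f n := by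
  have := cum_unique (f := f) (F := fun k => cum f (k + n)) (fun k => by
    rw [show k + 1 + n = (k + n) + 1 by ring, cum_succ, hf]) k
  simp only [zero_add] at this
  rw [this, add_comm]

theorem cum_reflect (f : ℤ → ℤ) (k : ℤ) : cum (fun j => f (-1 - j)) k = -cum f (-k) := by
  have := cum_unique (f := fun j => f (-1 - j)) (F := fun k => -cum f (-k)) (fun k => by
    have h := cum_succ f (-1 - k)
    rw [show -1 - k + 1 = -k by ring] at h
    rw [show -(k + 1) = -1 - k by ring, h]
    ring) k
  simp only [neg_zero, cum_zero, zero_add] at this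
  exact this.symm

theorem cum_sub_le_of_le {f g : ℤ → ℤ} {k l : ℤ} (hkl : k ≤ l)
    (h : ∀ j, k ≤ j → j < l → f j ≤ g j) : cum f l - cum f k ≤ cum g l - cum g k := by
  induction l, hkl using Int.leInduction with
  | base => simp
  | succ l hl ih =>
    have h1 := ih (fun j h1 h2 => h j h1 (by omega))
    have h2 := h l hl (by omega)
    rw [cum_succ, cum_succ]
    linarith

theorem sum_zmod_eq_sum_range {n : ℕ} [NeZero n] {M : Type*} [AddCommMonoid M] (φ : ZMod n → M) :
    ∑ x, φ x = ∑ j ∈ Finset.range n, φ (j : ZMod n) := by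
  obtain ⟨m, rfl⟩ := Nat.exists_eq_succ_of_ne_zero (NeZero.ne n)
  rw [← Fin.sum_univ_eq_sum_range (fun j => φ (j : ZMod (m + 1)))]
  refine Finset.sum_congr rfl fun x _ => ?_
  congr 1
  exact (ZMod.natCast_zmod_val (n := m + 1) x).symm

theorem cum_period {n : ℕ} [NeZero n] (φ : ZMod n → ℤ) :
    cum (fun j => φ j) n = ∑ x, φ x := by
  rw [sum_zmod_eq_sum_range, cum, if_pos (by omega)]
  simp

/-! ### Words on a circle, and compatible pairs of sets of letters -/

/-- The function on `ZMod n` equal to `e` on `S`, to `-1` on `T` and to `0` elsewhere. -/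
def step {n : ℕ} (e : ℕ) (S T : Finset (ZMod n)) (x : ZMod n) : ℤ :=
  if x ∈ S then e else if x ∈ T then -1 else 0

/-- The height function of `step`. -/
def height {n : ℕ} (e : ℕ) (S T : Finset (ZMod n)) (k : ℤ) : ℤ :=
  cum (fun j => step e S T j) k

section Height

variable {n : ℕ} (e : ℕ) (S T : Finset (ZMod n))

theorem height_succ (k : ℤ) : height e S T (k + 1) = height e S T k + step e S T k :=
  cum_succ _ _

theorem height_add_period [NeZero n] (k : ℤ) :
    height e S T (k + n) = height e S T k + ∑ x, step e S T x := by
  rw [height, cum_add_period (fun j => by simp), cum_period (step e S T)]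
  rfl

theorem sum_step [NeZero n] (h : Disjoint S T) :
    ∑ x, step e S T x = (e : ℤ) * S.card - T.card := by
  have : ∀ x, step e S T x = (if x ∈ S then (e : ℤ) else 0) - (if x ∈ T then 1 else 0) := by
    intro x
    have : x ∈ S → x ∉ T := fun hx => Finset.disjoint_left.1 h hx
    unfold step
    split_ifs <;> simp_all
  simp only [this, Finset.sum_sub_distrib, Finset.sum_ite_mem, Finset.univ_inter]
  simp [mul_comm]

end Height

/-- Compatibility of a set `S` of letters in `H` with a set `S'` of letters outside `H`: between a
letter in `S` and a letter in `S'` after it, there is a place where the height of `S` (counted from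
the left) or that of `S'` (counted from the right) has come down to zero. -/
def Compat {n : ℕ} [NeZero n] (b c : ℕ) (H : Finset (ZMod n)) (S S' : Finset (ZMod n)) : Prop :=
  ∀ i j : ℤ, i < j → j < i + n → (i : ZMod n) ∈ S → (j : ZMod n) ∈ S' →
    ∃ k, i < k ∧ k ≤ j ∧ (height c S Hᶜ k ≤ height c S Hᶜ i ∨
      height b S' H (j + 1) ≤ height b S' H k)

/-! ### Letters outside the shadow of a set, and their number. -/

/-- The letter `x` is not in the shadow of `S`. -/
def IsFree {n : ℕ} [NeZero n] (c : ℕ) (H S : Finset (ZMod n)) (x : ZMod n) : Prop :=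
  ∀ j : ℤ, (j : ZMod n) = x → ∀ i, j - n < i → i < j → height c S Hᶜ j ≤ height c S Hᶜ i

open Classical in
/-- The letters outside `H` that are not in the shadow of `S`. -/
noncomputable def freeSet {n : ℕ} [NeZero n] (c : ℕ) (H S : Finset (ZMod n)) : Finset (ZMod n) :=
  Hᶜ.filter (IsFree c H S)

section Free

variable {n : ℕ} [NeZero n] {c : ℕ} {H S : Finset (ZMod n)}

theorem mem_freeSet {x : ZMod n} : x ∈ freeSet c H S ↔ x ∉ H ∧ IsFree c H S x := by
  simp [freeSet]

/-- Shifting a window by a multiple of `n` changes all its heights by one and the same multiple of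
the total drift, so a single lift of the letter to the integers suffices. -/
theorem isFree_intCast (j : ℤ) : IsFree c H S (j : ZMod n) ↔
    ∀ i, j - n < i → i < j → height c S Hᶜ j ≤ height c S Hᶜ i := by
  refine ⟨fun h => h j rfl, fun h j' hj' i hi1 hi2 => ?_⟩
  obtain ⟨m, hm⟩ := (ZMod.intCast_eq_intCast_iff_dvd_sub _ _ _).1 hj'
  have key : ∀ m k : ℤ, height c S Hᶜ (k + n * m) =
      height c S Hᶜ k + m * ∑ x, step c S Hᶜ x := by
    intro m
    induction m using Int.induction_on with
    | zero => simp
    | succ m ih => intro k; rw [mul_add, mul_one, ← add_assoc, height_add_period, ih]; ring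
    | pred m ih =>
      intro k
      have := height_add_period c S Hᶜ (k + n * (-(m : ℤ) - 1))
      rw [show k + (n : ℤ) * (-m - 1) + n = k + n * (-m) by ring, ih] at this
      linarith
  have h1 := h (i + n * m) (by linarith) (by linarith)
  rw [show j = j' + n * m by linarith, key, key] at h1
  linarith

theorem step_of_notMem_of_notMem (hS : S ⊆ H) {x : ZMod n} (hx : x ∉ H) :
    step c S Hᶜ x = -1 := by
  rw [step, if_neg (fun h => hx (hS h)), if_pos (by simpa using hx)]

theorem step_nonneg {x : ZMod n} (hx : x ∈ H) : 0 ≤ step c S Hᶜ x := by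
  unfold step
  split_ifs with h1 h2
  · positivity
  · simp_all
  · rfl

theorem sum_step_compl (hS : S ⊆ H) :
    ∑ x, step c S Hᶜ x = (c : ℤ) * S.card - Hᶜ.card :=
  sum_step _ _ _ (Finset.disjoint_left.2 fun x hx hx' => by simp at hx'; exact hx' (hS hx))

/-- If the total drift is nonpositive, the number of free letters is the drop of the running
minimum along a period. -/
theorem card_freeSet_of_le (hS : S ⊆ H) (hle : c * S.card ≤ Hᶜ.card) :
    ((freeSet c H S).card : ℤ) = Hᶜ.card - c * S.card := by
  set F := height c S Hᶜ with hF
  have hper : ∀ k, F (k + n) = F k + ((c : ℤ) * S.card - Hᶜ.card) := fun k => by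
    rw [hF, height_add_period, sum_step_compl hS]
  have hn : 0 < n := Nat.pos_of_ne_zero (NeZero.ne n)
  have hne : (Finset.range n).Nonempty := Finset.nonempty_range_iff.2 hn.ne'
  -- The minimum of the height over the window `(j - n, j]`. It drops by one exactly at the free
  -- letters and is constant otherwise, and its drop along a period is minus the drift.
  set m : ℤ → ℤ := fun j => (Finset.range n).inf' hne fun k => F (j - k) with hm
  have hm_le : ∀ j i : ℤ, j - n < i → i ≤ j → m j ≤ F i := by
    intro j i h1 h2
    have := Finset.inf'_le (fun k : ℕ => F (j - k)) (b := (j - i).toNat)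
      (Finset.mem_range.2 (by omega : (j - i).toNat < n))
    rwa [show j - ((j - i).toNat : ℤ) = i by omega] at this
  have le_hm : ∀ j t : ℤ, (∀ i, j - n < i → i ≤ j → t ≤ F i) → t ≤ m j := by
    intro j t h
    refine Finset.le_inf' _ _ fun k hk => h _ ?_ ?_
    · have := Finset.mem_range.1 hk; omega
    · omega
  have hstep : ∀ j, m (j + 1) = min (F (j + 1)) (m j) := by
    intro j
    refine le_antisymm (le_min (hm_le _ _ (by omega) le_rfl) ?_) (le_hm _ _ ?_)
    · refine le_hm _ _ fun i h1 h2 => ?_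
      -- The place that leaves the window: one period later the height is no larger, since the drift
      -- is nonpositive.
      by_cases h3 : i = j - n + 1
      · have h4 := hper i
        have h5 := hm_le (j + 1) (j + 1) (by omega) le_rfl
        rw [show i + n = j + 1 by omega] at h4
        have : (c : ℤ) * S.card ≤ Hᶜ.card := by exact_mod_cast hle
        linarith
      · exact hm_le _ _ (by omega) (by omega)
    · intro i h1 h2
      by_cases h3 : i = j + 1
      · subst h3; exact min_le_left _ _
      · exact (min_le_right _ _).trans (hm_le _ _ (by omega) (by omega))
  have hsucc : ∀ j : ℤ, F (j + 1) = F j + step c S Hᶜ j := fun j => height_succ _ _ _ _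
  have hdrop : ∀ j : ℤ, m j - m (j + 1) = if (j : ZMod n) ∈ freeSet c H S then 1 else 0 := by
    intro j
    rw [hstep]
    have hmj := hm_le j j (by omega) le_rfl
    split_ifs with hj
    · obtain ⟨h1, h2⟩ := mem_freeSet.1 hj
      rw [isFree_intCast] at h2
      have h3 := hsucc j
      rw [step_of_notMem_of_notMem hS h1] at h3
      have h4 : F j ≤ m j := le_hm _ _ fun i hi1 hi2 => by
        rcases hi2.lt_or_eq with h | h
        · exact h2 i hi1 h
        · rw [h]
      rw [min_eq_left (by linarith)]
      linarith
    · rw [min_eq_right, sub_self]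
      by_cases hH : (j : ZMod n) ∈ H
      · have := step_nonneg (c := c) (S := S) hH
        linarith [hsucc j]
      · have h2 : ¬ IsFree c H S (j : ZMod n) := fun h => hj (mem_freeSet.2 ⟨hH, h⟩)
        rw [isFree_intCast] at h2
        push Not at h2
        obtain ⟨i, hi1, hi2, hi3⟩ := h2
        have h3 := hsucc j
        rw [step_of_notMem_of_notMem hS hH] at h3
        have := hm_le j i hi1 hi2.le
        have hi4 : F i < F j := hi3
        omega
  have hmper : m n = m 0 + ((c : ℤ) * S.card - Hᶜ.card) := by
    refine le_antisymm ?_ (le_hm _ _ fun i h1 h2 => ?_)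
    · rw [← sub_le_iff_le_add]
      refine le_hm _ _ fun i h1 h2 => ?_
      rw [sub_le_iff_le_add, ← hper]
      exact hm_le _ _ (by omega) (by omega)
    · have := hper (i - n)
      rw [sub_add_cancel] at this
      rw [this]
      have := hm_le 0 (i - n) (by omega) (by omega)
      linarith
  have htel : ∑ j ∈ Finset.range n, (m (j : ℤ) - m ((j : ℤ) + 1)) = m 0 - m n := by
    have := Finset.sum_range_sub' (fun j : ℕ => m (j : ℤ)) n
    simpa using this
  have hcount : ((freeSet c H S).card : ℤ) =
      ∑ x : ZMod n, if x ∈ freeSet c H S then (1 : ℤ) else 0 := by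
    simp [Finset.sum_ite_mem]
  rw [hcount, sum_zmod_eq_sum_range]
  have : ∀ j ∈ Finset.range n, (if ((j : ℕ) : ZMod n) ∈ freeSet c H S then (1 : ℤ) else 0) =
      m (j : ℤ) - m ((j : ℤ) + 1) := fun j _ => by
    rw [hdrop, Int.cast_natCast]
  rw [Finset.sum_congr rfl this, htel, hmper]
  ring

/-- A letter outside `H` makes the place `j - n + 1` lower than `j - n`, which under positive drift
is itself lower than `j`. -/
theorem freeSet_eq_empty_of_lt (hS : S ⊆ H) (hlt : Hᶜ.card < c * S.card) :
    freeSet c H S = ∅ := by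
  rw [Finset.eq_empty_iff_forall_notMem]
  intro x hx
  obtain ⟨j, rfl⟩ := ZMod.intCast_surjective x
  obtain ⟨h1, h2⟩ := mem_freeSet.1 hx
  rw [isFree_intCast] at h2
  have hper := height_add_period c S Hᶜ (j - n)
  rw [sub_add_cancel, sum_step_compl hS] at hper
  have hs := height_succ c S Hᶜ (j - n)
  have hcast : ((j - n : ℤ) : ZMod n) = (j : ZMod n) := by simp
  rw [hcast, step_of_notMem_of_notMem hS h1] at hs
  have hn : 0 < n := Nat.pos_of_ne_zero (NeZero.ne n)
  have : (Hᶜ.card : ℤ) < c * S.card := by exact_mod_cast hlt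
  have h3 : height c S Hᶜ j ≤ height c S Hᶜ (j - n + 1) := by
    rcases (show j - n + 1 ≤ j by omega).lt_or_eq with h | h
    · exact h2 _ (by omega) h
    · rw [h]
  linarith

/-- Only the size of `S` enters, not its position; this lets all sets `S` of one size share the same
power of `1 + X`. -/
theorem card_freeSet (hS : S ⊆ H) :
    (freeSet c H S).card = ((Hᶜ.card : ℤ) - c * S.card).toNat := by
  rcases le_or_gt (c * S.card) Hᶜ.card with h | h
  · rw [← card_freeSet_of_le hS h, Int.toNat_natCast]
  · rw [freeSet_eq_empty_of_lt hS h, Finset.card_empty]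
    have : (Hᶜ.card : ℤ) < c * S.card := by exact_mod_cast h
    omega

end Free

/-! ### Compatibility and deletion of free letters. -/

section Compat

variable {n : ℕ} [NeZero n] {b c : ℕ} {H S S' : Finset (ZMod n)}

omit [NeZero n] in
theorem step_mono {S₁ S₂ T : Finset (ZMod n)} (h : S₁ ⊆ S₂) (hT : ∀ x ∈ T, x ∉ S₂) (x : ZMod n) :
    step b S₁ T x ≤ step b S₂ T x := by
  unfold step
  have := @h x
  have := hT x
  split_ifs <;> simp_all

theorem Compat.mono (hc : Compat b c H S S') (hS' : S' ⊆ Hᶜ) {S'' : Finset (ZMod n)}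
    (h : S'' ⊆ S') : Compat b c H S S'' := by
  intro i j hij hji hi hj
  obtain ⟨k, h1, h2, h3⟩ := hc i j hij hji hi (h hj)
  refine ⟨k, h1, h2, h3.imp_right fun h4 => ?_⟩
  have := cum_sub_le_of_le (f := fun j => step b S'' H j) (g := fun j => step b S' H j)
    (show k ≤ j + 1 by omega) (fun l _ _ => step_mono h (fun x hx hx' => by
      simpa [hx] using hS' hx') _)
  change height b S'' H _ - height b S'' H _ ≤ height b S' H _ - height b S' H _ at this
  linarith

/-- If the height of `S` comes back down between `i` and `j`, this pair imposes nothing on `S'`. If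
not, no letter after `i` up to `j` is free, so deleting free letters does not affect the height of
`S'` there. -/
theorem compat_sdiff_freeSet (hS' : S' ⊆ Hᶜ) :
    Compat b c H S (S' \ freeSet c H S) ↔ Compat b c H S S' := by
  refine ⟨fun hc i j hij hji hi hj => ?_, fun hc => hc.mono hS' Finset.sdiff_subset⟩
  by_cases hex : ∃ k, i < k ∧ k ≤ j ∧ height c S Hᶜ k ≤ height c S Hᶜ i
  · obtain ⟨k, h1, h2, h3⟩ := hex
    exact ⟨k, h1, h2, Or.inl h3⟩
  push Not at hex
  have hnf : ∀ l : ℤ, i < l → l ≤ j → (l : ZMod n) ∉ freeSet c H S := by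
    intro l h1 h2 h3
    have h4 := (isFree_intCast l).1 (mem_freeSet.1 h3).2 i (by omega) h1
    exact absurd (hex l h1 h2) (not_lt.2 h4)
  obtain ⟨k, h1, h2, h3⟩ := hc i j hij hji hi (Finset.mem_sdiff.2 ⟨hj, hnf j hij le_rfl⟩)
  refine ⟨k, h1, h2, Or.inr ?_⟩
  have h4 := h3.resolve_left (not_le.2 (hex k h1 h2))
  have := cum_sub_le_of_le (f := fun j => step b S' H j)
    (g := fun j => step b (S' \ freeSet c H S) H j)
    (show k ≤ j + 1 by omega) (fun l hl1 hl2 => le_of_eq (by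
      have := hnf l (by omega) (by omega)
      simp [step, this]))
  change height b S' H _ - height b S' H _ ≤
    height b (S' \ freeSet c H S) H _ - height b (S' \ freeSet c H S) H _ at this
  linarith

end Compat

end RankTwo

namespace RankTwo

/-! ### The area under a compatible pair -/

/-- The word with letters in `H` and outside `H` follows the line of slope `a₂ / a₁`. -/
def IsBalanced {n : ℕ} (a₁ a₂ : ℕ) (H : Finset (ZMod n)) : Prop :=
  ∃ r : ℤ → ℤ, (∀ j, 0 ≤ r j ∧ r j < a₁ + a₂) ∧ (∀ j, r (j + n) = r j) ∧
    ∀ j : ℤ, ((j : ZMod n) ∈ H → r (j + 1) = r j + a₂) ∧ ((j : ZMod n) ∉ H → r (j + 1) = r j - a₁)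

section Area

variable {n : ℕ} [NeZero n] {b c : ℕ} {H S S' : Finset (ZMod n)}

omit [NeZero n] in
/-- A function on the integers attains its minimum over a window of length `n`; the last place
where it does. -/
theorem exists_last_min (F : ℤ → ℤ) (hn : 0 < n) :
    ∃ i : ℤ, 0 ≤ i ∧ i < n ∧ (∀ k : ℤ, 0 ≤ k → k < n → F i ≤ F k) ∧
      ∀ k : ℤ, i < k → k < n → F i < F k := by
  have hne : (Finset.Ico (0 : ℤ) n).Nonempty := ⟨0, by simp [hn]⟩
  obtain ⟨i₀, hi₀, hmin⟩ := Finset.exists_min_image _ F hne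
  have hne' : ((Finset.Ico (0 : ℤ) n).filter fun k => F k ≤ F i₀).Nonempty :=
    ⟨i₀, by simp [hi₀]⟩
  obtain ⟨i, hi, hmax⟩ := Finset.exists_max_image _ id hne'
  simp only [Finset.mem_filter, Finset.mem_Ico, id] at hi hmax hmin
  refine ⟨i, hi.1.1, hi.1.2, fun k h1 h2 => hi.2.trans (hmin k ⟨h1, h2⟩), fun k h1 h2 => ?_⟩
  by_contra h3
  have := hmax k ⟨⟨by omega, h2⟩, by omega⟩
  omega

theorem step_eq_neg_one (hS : S' ⊆ Hᶜ) {x : ZMod n} (hx : x ∈ H) : step b S' H x = -1 := by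
  rw [step, if_neg (fun h => by simpa [hx] using hS h), if_pos hx]

/-- As long as the height of `S` stays positive after a letter in `S`, the height of a compatible
`S'` does not exceed its value after that letter. -/
theorem Compat.height_le (hc : Compat b c H S S') {i k : ℤ}
    (hi : (i : ZMod n) ∈ S) (hkn : k ≤ i + n)
    (hpos : ∀ l, i < l → l < k → height c S Hᶜ i < height c S Hᶜ l) :
    ∀ l, i < l → l ≤ k → height b S' H l ≤ height b S' H (i + 1) := by
  suffices ∀ m : ℕ, ∀ l, l = i + 1 + m → l ≤ k → height b S' H l ≤ height b S' H (i + 1) from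
    fun l h1 h2 => this (l - i - 1).toNat l (by omega) h2
  intro m
  induction m using Nat.strong_induction_on with
  | _ m ih =>
    intro l hl hlk
    rcases Nat.eq_zero_or_pos m with rfl | hm
    · rw [hl]; simp
    -- Only a letter of `S'` can raise the height, and compatibility with `i` then provides an
    -- earlier place at least as high as `l`.
    by_cases hmem : ((l - 1 : ℤ) : ZMod n) ∈ S'
    · obtain ⟨l', h1, h2, h3⟩ := hc i (l - 1) (by omega) (by omega) hi hmem
      have h4 := h3.resolve_left (not_le.2 (hpos l' h1 (by omega)))
      rw [sub_add_cancel] at h4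
      exact h4.trans (ih (l' - i - 1).toNat (by omega) l' (by omega) (by omega))
    · have h1 := height_succ b S' H (l - 1)
      rw [sub_add_cancel] at h1
      have h2 : step b S' H ((l - 1 : ℤ) : ZMod n) ≤ 0 := by
        rw [step, if_neg hmem]
        split_ifs <;> omega
      have h3 := ih (m - 1) (by omega) (l - 1) (by omega) (by omega)
      linarith

theorem isFree_of_eq_empty (x : ZMod n) : IsFree c H ∅ x := by
  intro j _ i _ hij
  have := cum_sub_le_of_le (f := fun j => step c ∅ Hᶜ (j : ZMod n)) (g := fun _ => 0) hij.le
    (fun l _ _ => by unfold step; split_ifs <;> simp_all)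
  have h0 : ∀ k, cum (fun _ => 0) k = 0 := fun k => by simp [cum]
  rw [h0, h0] at this
  change height c ∅ Hᶜ j - height c ∅ Hᶜ i ≤ _ at this
  linarith

/-- Under positive drift the height of `S` stays above its last minimum for a whole period, and the
letter at that minimum is in `S`. By `Compat.height_le` the height of `S'` never recovers from the
loss at this letter, so its own drift is negative. -/
theorem Compat.card_lt_of_lt (hc : Compat b c H S S') (hS : S ⊆ H) (hS' : S' ⊆ Hᶜ) (hn : 1 < n)
    (hlt : Hᶜ.card < c * S.card) : b * S'.card < H.card := by
  obtain ⟨i, h0, h1, h2, h3⟩ := exists_last_min (n := n) (height c S Hᶜ) (by omega)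
  have hlt' : (Hᶜ.card : ℤ) < c * S.card := by exact_mod_cast hlt
  have hpos : ∀ l, i < l → l < i + n → height c S Hᶜ i < height c S Hᶜ l := by
    intro l hl1 hl2
    rcases lt_or_ge l n with h | h
    · exact h3 l hl1 h
    · have h4 := height_add_period c S Hᶜ (l - n)
      rw [sub_add_cancel, sum_step_compl hS] at h4
      have := h2 (l - n) (by omega) (by omega)
      linarith
  have hi : (i : ZMod n) ∈ S := by
    by_contra hi
    have h4 := hpos (i + 1) (by omega) (by omega)
    rw [height_succ, step, if_neg hi] at h4
    split_ifs at h4 <;> omega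
  have h4 := hc.height_le hi (k := i + n) le_rfl hpos (i + n) (by omega) le_rfl
  rw [height_add_period, height_succ, step_eq_neg_one hS' (hS hi),
    sum_step _ _ _ (Finset.disjoint_left.2 fun x hx hx' => by simpa [hx'] using hS' hx)] at h4
  have : (b : ℤ) * S'.card < H.card := by linarith
  exact_mod_cast this

/-- If all letters of `S'` are in the shadow of `S`, where `S` and `S'` are compatible, then `S`
outweighs `S'`. -/
theorem Compat.mul_card_lt {a₁ a₂ : ℕ} (hn : n = a₁ + a₂) (ha₁ : 0 < a₁) (ha₂ : 0 < a₂)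
    (hH : H.card = a₁) (hbal : IsBalanced a₁ a₂ H) (hc0 : 0 < c)
    (hc : Compat b c H S S') (hS : S ⊆ H) (hS' : S' ⊆ Hᶜ \ freeSet c H S)
    (hne : ¬ (S = ∅ ∧ S' = ∅)) : b * S'.card * a₂ < c * S.card * a₁ := by
  have hHc : Hᶜ.card = a₂ := by
    rw [Finset.card_compl, ZMod.card, hH]; omega
  have hS'' : S' ⊆ Hᶜ := hS'.trans Finset.sdiff_subset
  have hS0 : S ≠ ∅ := by
    rintro rfl
    refine hne ⟨rfl, ?_⟩
    rw [Finset.eq_empty_iff_forall_notMem]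
    intro x hx
    have := Finset.mem_sdiff.1 (hS' hx)
    exact this.2 (mem_freeSet.2 ⟨by simpa using this.1, isFree_of_eq_empty x⟩)
  rcases lt_or_ge Hᶜ.card (c * S.card) with hlt | hge
  · have h1 := hc.card_lt_of_lt hS hS'' (by omega) hlt
    rw [hHc] at hlt
    rw [hH] at h1
    calc b * S'.card * a₂ < a₁ * a₂ := by gcongr
      _ = a₂ * a₁ := mul_comm _ _
      _ < c * S.card * a₁ := by gcongr
  obtain ⟨r, hr, hrper, hrstep⟩ := hbal
  set F := height c S Hᶜ with hF
  set G := height b S' H with hG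
  have hFper : ∀ k, F (k + n) = F k + ((c : ℤ) * S.card - a₂) := fun k => by
    rw [hF, height_add_period, sum_step_compl hS, hHc]
  have hGper : ∀ k, G (k + n) = G k + ((b : ℤ) * S'.card - a₁) := fun k => by
    rw [hG, height_add_period, sum_step _ _ _ (Finset.disjoint_left.2 fun x hx hx' => by
      simpa [hx'] using hS'' hx), hH]
  have hFs : ∀ k : ℤ, F (k + 1) = F k + step c S Hᶜ k := fun k => height_succ _ _ _ _
  have hGs : ∀ k : ℤ, G (k + 1) = G k + step b S' H k := fun k => height_succ _ _ _ _
  have hge' : (c : ℤ) * S.card ≤ a₂ := by rw [hHc] at hge; exact_mod_cast hge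
  obtain ⟨k₀, hk1, hk2, hk3, -⟩ := exists_last_min (n := n) F (by omega)
  have hlow : ∀ i, k₀ - n < i → i ≤ k₀ → F k₀ ≤ F i := by
    intro i h1 h2
    rcases lt_or_ge i 0 with h | h
    · have := hFper i
      have := hk3 (i + n) (by omega) (by omega)
      linarith
    · exact hk3 i h (by omega)
  -- The term `r` cancels the letters in neither `S` nor `S'`, and along a period `Ψ` gains `a₁ c
  -- |S| - a₂ b |S'|`. To show that this is positive, `Ψ` is followed along the successive weak
  -- minima (records) of `F` from `k₀` on.
  set Ψ : ℤ → ℤ := fun k => a₁ * F k - a₂ * G k - r k with hΨ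
  have key : ∀ m : ℕ, ∀ k, k = k₀ + m → k ≤ k₀ + n → (∀ i, k₀ ≤ i → i < k → F k ≤ F i) →
      Ψ k₀ ≤ Ψ k ∧ (Ψ k₀ < Ψ k ∨ ∀ i : ℤ, k₀ ≤ i → i < k → (i : ZMod n) ∉ S) := by
    intro m
    induction m using Nat.strong_induction_on with
    | _ m ih =>
      intro k hk hkn hrec
      rcases Nat.eq_zero_or_pos m with rfl | hm
      · have : k = k₀ := by simpa using hk
        subst this
        exact ⟨le_rfl, Or.inr fun i h1 h2 => by omega⟩
      -- the last record before `k`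
      have hex : ((Finset.Ico k₀ k).filter
          fun l => ∀ i, k₀ ≤ i → i < l → F l ≤ F i).Nonempty :=
        ⟨k₀, by simp only [Finset.mem_filter, Finset.mem_Ico]; exact ⟨by omega, by omega⟩⟩
      obtain ⟨l, hl, hlmax⟩ := Finset.exists_max_image _ id hex
      simp only [Finset.mem_filter, Finset.mem_Ico, id] at hl hlmax
      obtain ⟨⟨hl1, hl2⟩, hl3⟩ := hl
      obtain ⟨hih1, hih2⟩ := ih (l - k₀).toNat (by omega) l (by omega) (by omega) hl3
      have habove : ∀ i, l < i → i < k → F l < F i := by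
        suffices ∀ t : ℕ, ∀ i, i = l + t → l < i → i < k → F l < F i from
          fun i h1 h2 => this (i - l).toNat i (by omega) h1 h2
        intro t
        induction t using Nat.strong_induction_on with
        | _ t iht =>
          intro i hit h1 h2
          by_contra h3
          have := hlmax i ⟨⟨by omega, h2⟩, fun i' h4 h5 => ?_⟩
          · omega
          · rcases lt_trichotomy i' l with h | h | h
            · have := hl3 i' h4 h; omega
            · subst h; omega
            · have := iht (i' - l).toNat (by omega) i' (by omega) h (by omega)
              omega
      have hFkl : F k ≤ F l := hrec l hl1 hl2
      -- Either a single letter separates the two records, and it is in neither `S` nor `S'` (in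
      -- `S'` it would be free), or `F` makes an excursion above `F l`, opened by a letter of `S`
      -- and closed by a letter outside `H`.
      rcases (show l = k - 1 ∨ l < k - 1 by omega) with hlk | hlk
      · obtain rfl : k = l + 1 := by omega
        have hlS : (l : ZMod n) ∉ S := fun h => by
          have := hFs l
          rw [step, if_pos h] at this
          have : (0 : ℤ) < c := by exact_mod_cast hc0
          linarith
        have hlS' : (l : ZMod n) ∉ S' := fun h => by
          have h1 := Finset.mem_sdiff.1 (hS' h)
          refine h1.2 (mem_freeSet.2 ⟨by simpa using h1.1, (isFree_intCast l).2 fun i h2 h3 => ?_⟩)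
          rcases lt_or_ge i k₀ with h | h
          · have h4 : F l ≤ F k₀ := by
              rcases hl1.lt_or_eq with h5 | h5
              · exact hl3 k₀ le_rfl h5
              · rw [h5]
            exact h4.trans (hlow i (by omega) h.le)
          · exact hl3 i h h3
        have hΨl : Ψ (l + 1) = Ψ l := by
          have h1 := hFs l
          have h2 := hGs l
          rw [step, if_neg hlS] at h1
          rw [step, if_neg hlS'] at h2
          simp only [hΨ]
          by_cases hlH : (l : ZMod n) ∈ H
          · have h3 := (hrstep l).1 hlH
            rw [if_neg (by simpa using hlH)] at h1
            rw [if_pos hlH] at h2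
            rw [h1, h2, h3]; ring
          · have h3 := (hrstep l).2 hlH
            rw [if_pos (by simpa using hlH)] at h1
            rw [if_neg hlH] at h2
            rw [h1, h2, h3]; ring
        rw [hΨl]
        refine ⟨hih1, hih2.imp_right fun h i h1 h2 => ?_⟩
        rcases (show i < l ∨ i = l by omega) with h3 | rfl
        · exact h i h1 h3
        · exact hlS
      · have hlS : (l : ZMod n) ∈ S := by
          by_contra h
          have h1 := hFs l
          rw [step, if_neg h] at h1
          have := habove (l + 1) (by omega) (by omega)
          split_ifs at h1 <;> omega
        have hlast := hFs (k - 1)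
        rw [sub_add_cancel] at hlast
        have hF1 := habove (k - 1) (by omega) (by omega)
        have hkH : ((k - 1 : ℤ) : ZMod n) ∉ H := fun h => by
          have := step_nonneg (c := c) (S := S) h
          linarith
        rw [step_of_notMem_of_notMem hS hkH] at hlast
        have hFeq : F k = F l := by omega
        have hG1 : G k ≤ G l - 1 := by
          have h1 := hc.height_le hlS (k := k) (by omega) habove k hl2 le_rfl
          have h2 := hGs l
          rw [step_eq_neg_one hS'' (hS hlS)] at h2
          change G k ≤ G (l + 1) at h1
          linarith
        -- The closing letter lowers `r` by `a₁` from a value below `a₁ + a₂`. This bound is what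
        -- makes the gain of `Ψ` strict.
        have hrk : r k - r l < a₂ := by
          have h1 := (hrstep (k - 1)).2 hkH
          rw [sub_add_cancel] at h1
          linarith [(hr (k - 1)).2, (hr l).1]
        have hlt : Ψ l < Ψ k := by
          simp only [hΨ]
          rw [hFeq]
          have : (a₂ : ℤ) * G k ≤ a₂ * (G l - 1) := by gcongr
          linarith
        exact ⟨by omega, Or.inl (by omega)⟩
  have hend := key n (k₀ + n) rfl le_rfl (fun i h1 h2 => by
    rw [hFper]
    rcases (show i = k₀ ∨ k₀ < i by omega) with rfl | h
    · linarith
    · have h3 := hFper (i - n)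
      rw [sub_add_cancel] at h3
      have := hlow (i - n) (by omega) (by omega)
      linarith)
  have hlt : Ψ k₀ < Ψ (k₀ + n) := by
    refine hend.2.resolve_right fun h => hS0 ?_
    rw [Finset.eq_empty_iff_forall_notMem]
    intro x hx
    obtain ⟨j, rfl⟩ := ZMod.intCast_surjective x
    have hn0 : (0 : ℤ) < n := by omega
    refine h (k₀ + (j - k₀) % n) (by linarith [Int.emod_nonneg (j - k₀) hn0.ne'])
      (by linarith [Int.emod_lt_of_pos (j - k₀) hn0]) ?_
    have : ((k₀ + (j - k₀) % n : ℤ) : ZMod n) = (j : ZMod n) := by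
      rw [ZMod.intCast_eq_intCast_iff_dvd_sub]
      refine ⟨(j - k₀) / n, ?_⟩
      linarith [Int.emod_add_mul_ediv (j - k₀) n]
    rwa [this]
  simp only [hΨ, hFper, hGper, hrper] at hlt
  have : (b : ℤ) * S'.card * a₂ < c * S.card * a₁ := by linarith
  exact_mod_cast this

end Area

/-! ### Reversal -/

section Reversal

variable {n : ℕ} {b c : ℕ} {H S S' : Finset (ZMod n)}

/-- Reading a set of letters on a circle backwards. -/
def rev (S : Finset (ZMod n)) : Finset (ZMod n) :=
  S.map (Equiv.subLeft (-1 : ZMod n)).toEmbedding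

theorem mem_rev {x : ZMod n} : x ∈ rev S ↔ -1 - x ∈ S := by
  rw [rev, Finset.mem_map_equiv, Equiv.subLeft_symm_apply]
  rw [show -x + -1 = -1 - x by ring]

theorem rev_rev (S : Finset (ZMod n)) : rev (rev S) = S := by
  ext x; simp [mem_rev]

theorem card_rev (S : Finset (ZMod n)) : (rev S).card = S.card := Finset.card_map _

theorem rev_subset_rev (h : S ⊆ S') : rev S ⊆ rev S' := Finset.map_subset_map.2 h

theorem rev_compl [NeZero n] (S : Finset (ZMod n)) : (rev S)ᶜ = rev Sᶜ := by
  ext x; simp [mem_rev]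

/-- Letter `j` lies between the places `j` and `j + 1`, so `j ↦ -1 - j` on letters is `k ↦ -k` on
places. -/
theorem height_rev (e : ℕ) (S T : Finset (ZMod n)) (k : ℤ) :
    height e (rev S) (rev T) k = -height e S T (-k) := by
  rw [height, height, ← cum_reflect]
  congr 1
  ext j
  simp [step, mem_rev]

/-- Reversal exchanges the two kinds of letters and the two alternatives in the definition;
statements about rows thereby yield those about columns. -/
theorem Compat.rev [NeZero n] (h : Compat b c H S S') :
    Compat c b (rev Hᶜ) (rev S') (rev S) := by
  intro i j hij hji hi hj
  obtain ⟨k, h1, h2, h3⟩ := h (-1 - j) (-1 - i) (by omega) (by omega)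
    (by simpa [mem_rev] using hj) (by simpa [mem_rev] using hi)
  refine ⟨-k, by omega, by omega, ?_⟩
  rw [rev_compl, compl_compl]
  simp only [height_rev, neg_neg]
  rw [or_comm]
  refine h3.imp (fun h4 => ?_) (fun h4 => ?_)
  · rw [show -(j + 1) = -1 - j by ring]; linarith
  · rw [show -1 - i + 1 = -i by ring] at h4; linarith

theorem compat_rev_iff [NeZero n] :
    Compat c b (rev Hᶜ) (RankTwo.rev S') (RankTwo.rev S) ↔ Compat b c H S S' := by
  refine ⟨fun h => ?_, Compat.rev⟩
  have := h.rev
  rwa [rev_compl, compl_compl, rev_rev, rev_rev, rev_rev] at this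

theorem IsBalanced.rev [NeZero n] {a₁ a₂ : ℕ} (h : IsBalanced a₁ a₂ H) :
    IsBalanced a₂ a₁ (rev Hᶜ) := by
  obtain ⟨r, h1, h2, h3⟩ := h
  refine ⟨fun k => r (-k), fun j => ⟨(h1 _).1, by linarith [(h1 (-j)).2]⟩, fun j => ?_,
    fun j => ?_⟩
  · have := h2 (-(j + n))
    change r (-(j + n)) = r (-j)
    rw [← this]
    congr 1
    ring
  · have := h3 (-1 - j)
    rw [show -1 - j + 1 = -j by ring] at this
    simp only [mem_rev, Finset.mem_compl, not_not, neg_add_rev]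
    rw [show (((-1 - j : ℤ)) : ZMod n) = -1 - j by push_cast; ring] at this
    rw [show -1 + -j = -1 - j by ring]
    exact ⟨fun h => by linarith [this.2 h], fun h => by linarith [this.1 h]⟩

end Reversal

/-- There are balanced words of every slope. -/
theorem exists_isBalanced {a₁ a₂ n : ℕ} [NeZero n] (hn : n = a₁ + a₂) :
    ∃ H : Finset (ZMod n), H.card = a₁ ∧ IsBalanced a₁ a₂ H := by
  have hn0 : 0 < n := Nat.pos_of_ne_zero (NeZero.ne n)
  have hn' : (n : ℤ) = a₁ + a₂ := by exact_mod_cast hn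
  have hpos : (0 : ℤ) < n := by exact_mod_cast hn0
  -- A Christoffel word: with `r j` the residue of `a₂ j` modulo `n`, the letter `j` is in `H` when
  -- adding `a₂` does not wrap around.
  let H : Finset (ZMod n) := Finset.univ.filter fun x => ((a₂ : ℤ) * x.val) % n < a₁
  let r : ℤ → ℤ := fun j => ((a₂ : ℤ) * j) % n
  have hr : ∀ j, 0 ≤ r j ∧ r j < n := fun j => ⟨Int.emod_nonneg _ hpos.ne', Int.emod_lt_of_pos _ hpos⟩
  have hmem : ∀ j : ℤ, (j : ZMod n) ∈ H ↔ r j < a₁ := by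
    intro j
    simp only [H, r, Finset.mem_filter, Finset.mem_univ, true_and, ZMod.val_intCast]
    rw [Int.mul_emod, Int.emod_emod, ← Int.mul_emod]
  have hrs : ∀ j, r (j + 1) = (r j + a₂) % n := fun j => by
    simp only [r, mul_add, mul_one, Int.emod_add_emod]
  have hper : ∀ j, r (j + n) = r j := fun j => by simp [r, mul_add]
  have hstep : ∀ j : ℤ, ((j : ZMod n) ∈ H → r (j + 1) = r j + a₂) ∧
      ((j : ZMod n) ∉ H → r (j + 1) = r j - a₁) := by
    intro j
    rw [hmem, hrs]
    have := hr j
    refine ⟨fun h => Int.emod_eq_of_lt (by omega) (by omega), fun h => ?_⟩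
    rw [← Int.sub_emod_right, Int.emod_eq_of_lt (by omega) (by omega)]
    omega
  refine ⟨H, ?_, r, fun j => ⟨(hr j).1, by have := (hr j).2; omega⟩, hper, hstep⟩
  -- The increments of the periodic function `r` sum to zero over a period, which forces the number
  -- of letters in `H`.
  let φ : ZMod n → ℤ := fun x => if x ∈ H then (a₂ : ℤ) else -a₁
  have hcum : ∀ k, r k = r 0 + cum (fun j => φ j) k := cum_unique fun k => by
    by_cases h : (k : ZMod n) ∈ H
    · rw [(hstep k).1 h]; simp [φ, h]
    · rw [(hstep k).2 h]; simp [φ, h, sub_eq_add_neg]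
  have h1 := hcum n
  rw [cum_period φ] at h1
  have h2 : r n = r 0 := by simpa using hper 0
  have h3 : ∑ x, φ x = (H.card : ℤ) * (a₂ + a₁) - n * a₁ := by
    have : ∀ x, φ x = (if x ∈ H then ((a₂ : ℤ) + a₁) else 0) - a₁ := fun x => by
      simp only [φ]; split_ifs <;> ring
    simp only [this, Finset.sum_sub_distrib, Finset.sum_ite_mem, Finset.univ_inter]
    simp [ZMod.card]
  rw [h3, h2] at h1
  have h4 : (H.card : ℤ) * n = a₁ * n := by rw [hn'] at h1 ⊢; linarith
  exact_mod_cast mul_right_cancel₀ hpos.ne' h4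

end RankTwo

namespace RankTwo

open Polynomial Polynomial.Bivariate

/-! ### Region conditions on the coefficients of a bivariate polynomial

The coefficient of `x₁ ^ (b p) * x₂ ^ (c q)` is `(G.coeff q).coeff p`. -/

/-- The rows of `G` are divisible by powers of `1 + X`, and the quotients vanish on one side of the
diagonal. -/
def RowFactor (b c : ℕ) (a₁ a₂ : ℤ) (G : ℤ[X][Y]) : Prop :=
  ∀ q : ℕ, ∃ D : ℤ[X], G.coeff q = (1 + X) ^ (a₂ - c * q).toNat * D ∧
    ∀ p : ℕ, (p, q) ≠ (0, 0) → (c : ℤ) * q * a₁ ≤ b * p * a₂ → D.coeff p = 0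

/-- The quotients of the rows of `G` by powers of `1 + X` have no negative coefficients. -/
def RowNonneg (c : ℕ) (a₂ : ℤ) (G : ℤ[X][Y]) : Prop :=
  ∀ (q : ℕ) (D : ℤ[X]), G.coeff q = (1 + X) ^ (a₂ - c * q).toNat * D → ∀ p, 0 ≤ D.coeff p

/-- The conditions on divisibility and support that characterize greedy elements. -/
structure IsRegional (b c : ℕ) (a₁ a₂ : ℤ) (G : ℤ[X][Y]) : Prop where
  coeff_zero : (G.coeff 0).coeff 0 = 1
  row : RowFactor b c a₁ a₂ G
  col : RowFactor c b a₂ a₁ (swap G)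

/-- The positivity of the quotients of rows and columns. -/
structure IsPositive (b c : ℕ) (a₁ a₂ : ℤ) (G : ℤ[X][Y]) : Prop where
  row : RowNonneg c a₂ G
  col : RowNonneg b a₁ (swap G)

theorem coeff_coeff_swap (G : ℤ[X][Y]) (p q : ℕ) :
    ((swap G).coeff p).coeff q = (G.coeff q).coeff p := by
  induction G using Polynomial.induction_on' with
  | add f g hf hg => simp only [map_add, coeff_add, hf, hg]
  | monomial n f =>
    induction f using Polynomial.induction_on' with
    | add f g hf hg => simp only [map_add, coeff_add, hf, hg]
    | monomial m r =>
      rw [Bivariate.swap_monomial_monomial]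
      simp only [coeff_monomial]
      by_cases h1 : m = p <;> by_cases h2 : n = q <;> simp [h1, h2, coeff_monomial]

theorem swap_swap (G : ℤ[X][Y]) : swap (swap G) = G := Bivariate.swap_swap_apply G

theorem IsRegional.swap {b c : ℕ} {a₁ a₂ : ℤ} {G : ℤ[X][Y]} (h : IsRegional b c a₁ a₂ G) :
    IsRegional c b a₂ a₁ (Bivariate.swap G) :=
  ⟨by rw [coeff_coeff_swap]; exact h.1, h.3, by rw [swap_swap]; exact h.2⟩

theorem IsPositive.swap {b c : ℕ} {a₁ a₂ : ℤ} {G : ℤ[X][Y]} (h : IsPositive b c a₁ a₂ G) :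
    IsPositive c b a₂ a₁ (Bivariate.swap G) :=
  ⟨h.2, by rw [swap_swap]; exact h.1⟩

theorem one_add_X_monic : (1 + X : ℤ[X]).Monic := by
  rw [add_comm]; exact monic_X_add_C 1

theorem one_add_X_pow_ne_zero (n : ℕ) : ((1 + X : ℤ[X]) ^ n) ≠ 0 :=
  (one_add_X_monic.pow n).ne_zero

theorem RowNonneg.of_factor {c : ℕ} {a₂ : ℤ} {G : ℤ[X][Y]} (D : ℕ → ℤ[X])
    (hD : ∀ q, G.coeff q = (1 + X) ^ (a₂ - c * q).toNat * D q) (h : ∀ q p, 0 ≤ (D q).coeff p) :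
    RowNonneg c a₂ G := by
  intro q D' hD' p
  rw [hD q] at hD'
  rw [← mul_left_cancel₀ (one_add_X_pow_ne_zero _) hD']
  exact h q p

/-! ### The generating polynomial of compatible pairs -/

section CompatPoly

variable {n : ℕ} [NeZero n]

open Classical in
/-- The generating polynomial of compatible pairs. -/
noncomputable def compatPoly (b c : ℕ) (H : Finset (ZMod n)) : ℤ[X][Y] :=
  ∑ S ∈ H.powerset, ∑ S' ∈ Hᶜ.powerset,
    if Compat b c H S S' then monomial S.card (monomial S'.card 1) else 0

theorem swap_compatPoly (b c : ℕ) (H : Finset (ZMod n)) :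
    Bivariate.swap (compatPoly b c H) = compatPoly c b (rev Hᶜ) := by
  classical
  rw [compatPoly, compatPoly, map_sum, rev_compl, compl_compl]
  simp only [map_sum]
  rw [Finset.sum_comm]
  refine Finset.sum_nbij' rev rev ?_ ?_ (fun S _ => rev_rev S) (fun S _ => rev_rev S) ?_
  · intro S hS
    exact Finset.mem_powerset.2 (rev_subset_rev (Finset.mem_powerset.1 hS))
  · intro S hS
    refine Finset.mem_powerset.2 ?_
    rw [← rev_rev Hᶜ]
    exact rev_subset_rev (Finset.mem_powerset.1 hS)
  intro S' _
  refine Finset.sum_nbij' rev rev ?_ ?_ (fun S _ => rev_rev S) (fun S _ => rev_rev S) ?_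
  · intro S hS
    exact Finset.mem_powerset.2 (rev_subset_rev (Finset.mem_powerset.1 hS))
  · intro S hS
    refine Finset.mem_powerset.2 ?_
    rw [← rev_rev H]
    exact rev_subset_rev (Finset.mem_powerset.1 hS)
  intro S _
  rw [apply_ite Bivariate.swap, Bivariate.swap_monomial_monomial, map_zero, card_rev, card_rev]
  simp only [compat_rev_iff]

/-- The elements of a set on which a predicate on subsets does not depend contribute a power of
`1 + X` to the generating polynomial. -/
theorem sum_powerset_X_pow {α : Type*} [DecidableEq α] {U V : Finset α} (hUV : U ⊆ V)
    (P : Finset α → Prop) [DecidablePred P] (hP : ∀ S ⊆ V, P (S \ U) ↔ P S) :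
    (∑ S ∈ V.powerset, if P S then (X : ℤ[X]) ^ S.card else 0) =
      (1 + X) ^ U.card * ∑ S ∈ (V \ U).powerset, if P S then (X : ℤ[X]) ^ S.card else 0 := by
  have h1 : (1 + X : ℤ[X]) ^ U.card = ∑ A ∈ U.powerset, X ^ A.card := by
    rw [add_comm, ← Finset.sum_pow_mul_eq_add_pow]
    simp
  rw [h1, Finset.sum_mul_sum, ← Finset.sum_product']
  refine Finset.sum_nbij' (fun S => (S ∩ U, S \ U)) (fun A => A.1 ∪ A.2) ?_ ?_ ?_ ?_ ?_
  · intro S hS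
    simp only [Finset.mem_product, Finset.mem_powerset] at hS ⊢
    exact ⟨Finset.inter_subset_right, Finset.sdiff_subset_sdiff hS le_rfl⟩
  · intro A hA
    simp only [Finset.mem_product, Finset.mem_powerset] at hA ⊢
    exact Finset.union_subset (hA.1.trans hUV) (hA.2.trans Finset.sdiff_subset)
  · intro S _
    ext x
    simp only [Finset.mem_union, Finset.mem_inter, Finset.mem_sdiff]
    tauto
  · intro A hA
    simp only [Finset.mem_product, Finset.mem_powerset] at hA
    have h3 : ∀ x ∈ A.1, x ∈ U := fun x hx => hA.1 hx
    have h4 : ∀ x ∈ A.2, x ∉ U := fun x hx => (Finset.mem_sdiff.1 (hA.2 hx)).2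
    ext x
    · simp only [Finset.mem_union, Finset.mem_inter]
      have := h3 x; have := h4 x
      tauto
    · simp only [Finset.mem_union, Finset.mem_sdiff]
      have := h3 x; have := h4 x
      tauto
  · intro S hS
    have h2 := hP S (Finset.mem_powerset.1 hS)
    simp only
    by_cases h : P S
    · rw [if_pos h, if_pos (h2.2 h), ← pow_add, Finset.card_inter_add_card_sdiff]
    · rw [if_neg h, if_neg (fun h' => h (h2.1 h')), mul_zero]

open Classical in
/-- The quotients of the rows of `compatPoly` by powers of `1 + X`. -/
noncomputable def shadowPoly (b c : ℕ) (H : Finset (ZMod n)) (q : ℕ) : ℤ[X] :=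
  ∑ S ∈ H.powersetCard q, ∑ S' ∈ (Hᶜ \ freeSet c H S).powerset,
    if Compat b c H S S' then X ^ S'.card else 0

/-- For fixed `S`, each free letter may be in `S'` or not without affecting compatibility and so
contributes a factor `1 + X`. The number of these letters is the same for all `S` of size `q`. -/
theorem coeff_compatPoly (b c : ℕ) (H : Finset (ZMod n)) (q : ℕ) :
    (compatPoly b c H).coeff q =
      (1 + X) ^ ((Hᶜ.card : ℤ) - c * q).toNat * shadowPoly b c H q := by
  classical
  have h1 : (compatPoly b c H).coeff q = ∑ S ∈ H.powersetCard q, ∑ S' ∈ Hᶜ.powerset,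
      if Compat b c H S S' then X ^ S'.card else 0 := by
    rw [Finset.powersetCard_eq_filter, Finset.sum_filter, compatPoly, finsetSum_coeff]
    refine Finset.sum_congr rfl fun S _ => ?_
    rw [finsetSum_coeff]
    split_ifs with h
    · refine Finset.sum_congr rfl fun S' _ => ?_
      split_ifs
      · rw [coeff_monomial, if_pos h, monomial_one_right_eq_X_pow]
      · simp
    · refine Finset.sum_eq_zero fun S' _ => ?_
      split_ifs
      · rw [coeff_monomial, if_neg h]
      · simp
  rw [h1, shadowPoly, Finset.mul_sum]
  refine Finset.sum_congr rfl fun S hS => ?_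
  obtain ⟨h2, h3⟩ := Finset.mem_powersetCard.1 hS
  rw [sum_powerset_X_pow (U := freeSet c H S) (fun x hx => by simpa using (mem_freeSet.1 hx).1)
    (Compat b c H S) (fun S' hS' => compat_sdiff_freeSet hS'), card_freeSet h2, h3]

theorem shadowPoly_coeff_nonneg (b c : ℕ) (H : Finset (ZMod n)) (q p : ℕ) :
    0 ≤ (shadowPoly b c H q).coeff p := by
  rw [shadowPoly, finsetSum_coeff]
  refine Finset.sum_nonneg fun S _ => ?_
  rw [finsetSum_coeff]
  refine Finset.sum_nonneg fun S' _ => ?_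
  split_ifs
  · rw [coeff_X_pow]; split_ifs <;> simp
  · simp

theorem rowNonneg_compatPoly {b c a₂ : ℕ} {H : Finset (ZMod n)} (hH : Hᶜ.card = a₂) :
    RowNonneg c a₂ (compatPoly b c H) :=
  RowNonneg.of_factor (shadowPoly b c H) (fun q => by rw [coeff_compatPoly, hH])
    (shadowPoly_coeff_nonneg b c H)

/-- By `Compat.mul_card_lt`, every nonempty pair counted by `shadowPoly` lies strictly on one side
of the diagonal. -/
theorem rowFactor_compatPoly {b c a₁ a₂ : ℕ} {H : Finset (ZMod n)} (hn : n = a₁ + a₂)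
    (ha₁ : 0 < a₁) (ha₂ : 0 < a₂) (hc : 0 < c) (hH : H.card = a₁) (hbal : IsBalanced a₁ a₂ H) :
    RowFactor b c a₁ a₂ (compatPoly b c H) := by
  intro q
  have hHc : Hᶜ.card = a₂ := by
    rw [Finset.card_compl, ZMod.card, hH]; omega
  refine ⟨shadowPoly b c H q, by rw [coeff_compatPoly, hHc], fun p hpq hle => ?_⟩
  rw [shadowPoly, finsetSum_coeff]
  refine Finset.sum_eq_zero fun S hS => ?_
  obtain ⟨h2, h3⟩ := Finset.mem_powersetCard.1 hS
  rw [finsetSum_coeff]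
  refine Finset.sum_eq_zero fun S' hS' => ?_
  split_ifs with h
  · rw [coeff_X_pow, if_neg]
    intro h4
    have := h.mul_card_lt hn ha₁ ha₂ hH hbal hc h2 (Finset.mem_powerset.1 hS') (by
      rintro ⟨rfl, rfl⟩
      exact hpq (by simp_all))
    rw [h3, ← h4] at this
    have h5 : c * q * a₁ ≤ b * p * a₂ := by exact_mod_cast hle
    omega
  · simp

theorem coeff_zero_compatPoly (b c : ℕ) (H : Finset (ZMod n)) :
    ((compatPoly b c H).coeff 0).coeff 0 = 1 := by
  classical
  have hempty : Compat b c H (∅ : Finset (ZMod n)) ∅ := fun i j _ _ hi => by simp at hi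
  have hfree : freeSet c H ∅ = Hᶜ := by
    ext x; simp [mem_freeSet, isFree_of_eq_empty]
  rw [coeff_compatPoly, mul_coeff_zero, shadowPoly]
  simp [hfree, hempty, coeff_zero_eq_eval_zero]

theorem coeff_compatPoly_eq_zero {b c : ℕ} {H : Finset (ZMod n)} {q : ℕ} (hq : H.card < q) :
    (compatPoly b c H).coeff q = 0 := by
  rw [coeff_compatPoly, shadowPoly, Finset.powersetCard_eq_empty.2 hq]
  simp

end CompatPoly

/-- The last clause holds because `S` has at most `a₁` letters; it is what allows the rows to be
reversed later on. -/
theorem exists_isRegional_of_pos {b c : ℕ} (hb : 0 < b) (hc : 0 < c) {a₁ a₂ : ℕ} (ha₁ : 0 < a₁)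
    (ha₂ : 0 < a₂) : ∃ G : ℤ[X][Y], IsRegional b c a₁ a₂ G ∧ IsPositive b c a₁ a₂ G ∧
      ∀ q : ℕ, a₁ < q → G.coeff q = 0 := by
  have : NeZero (a₁ + a₂) := ⟨by omega⟩
  obtain ⟨H, hH, hbal⟩ := exists_isBalanced (n := a₁ + a₂) rfl
  have hHc : Hᶜ.card = a₂ := by
    rw [Finset.card_compl, ZMod.card, hH]; omega
  refine ⟨compatPoly b c H, ⟨coeff_zero_compatPoly b c H,
    rowFactor_compatPoly rfl ha₁ ha₂ hc hH hbal, ?_⟩, ⟨rowNonneg_compatPoly hHc, ?_⟩,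
    fun q hq => coeff_compatPoly_eq_zero (by omega)⟩
  · rw [swap_compatPoly]
    exact rowFactor_compatPoly (add_comm _ _) ha₂ ha₁ hb (by rw [card_rev, hHc]) hbal.rev
  · rw [swap_compatPoly]
    exact rowNonneg_compatPoly (by rw [rev_compl, compl_compl, card_rev, hH])

end RankTwo

namespace RankTwo

open Polynomial Polynomial.Bivariate

/-! ### Recurrence relations -/

/-- The inverse of `(1 + X) ^ n` as a power series. -/
theorem mk_choose_mul_one_add_X_pow (n : ℕ) :
    PowerSeries.mk (fun k => (-1 : ℤ) ^ k * ((n + k - 1).choose k : ℤ)) *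
      (1 + PowerSeries.X) ^ n = 1 := by
  induction n with
  | zero =>
    rw [pow_zero, mul_one]
    ext k
    rcases k with _ | k
    · simp
    · simp [PowerSeries.coeff_one]
  | succ n ih =>
    rw [pow_succ', ← mul_assoc]
    have h : PowerSeries.mk (fun k => (-1 : ℤ) ^ k * ((n + 1 + k - 1).choose k : ℤ)) *
        (1 + PowerSeries.X) =
          PowerSeries.mk (fun k => (-1 : ℤ) ^ k * ((n + k - 1).choose k : ℤ)) := by
      ext k
      rw [mul_add, mul_one, map_add]
      rcases k with _ | k
      · simp
      · rw [PowerSeries.coeff_succ_mul_X]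
        simp only [PowerSeries.coeff_mk]
        rw [show n + 1 + (k + 1) - 1 = (n + k) + 1 by omega, show n + 1 + k - 1 = n + k by omega,
          show n + (k + 1) - 1 = n + k by omega, Nat.choose_succ_succ]
        push_cast
        ring
    rw [h, ih]

theorem binom_natCast_add (n k : ℕ) (hn : 0 < n) (hk : 0 < k) :
    binom ((n : ℤ) + k - 1) k = ((n + k - 1).choose k : ℤ) := by
  rw [binom, if_pos (by omega)]
  congr 2
  omega

/-- The sums in the greedy recurrence compare the coefficients of a polynomial with those of its
quotient by a power of `1 + X`. -/
theorem sum_binom_eq_sub {R D : ℤ[X]} {m : ℤ} (h : R = (1 + X) ^ m.toNat * D) (p : ℕ) :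
    ∑ k ∈ Finset.Icc 1 p, (-1) ^ (k - 1) * R.coeff (p - k) * binom (m + k - 1) k =
      R.coeff p - D.coeff p := by
  rcases le_or_gt m 0 with hm | hm
  -- Here `m + k - 1 < k`, so all terms vanish by the convention in `binom`.
  · rw [Int.toNat_of_nonpos hm, pow_zero, one_mul] at h
    rw [h, sub_self]
    refine Finset.sum_eq_zero fun k hk => ?_
    rw [binom, if_neg (by omega), mul_zero]
  obtain ⟨n, rfl⟩ := Int.eq_ofNat_of_zero_le hm.le
  rw [Int.toNat_natCast] at h
  have h1 : (D : PowerSeries ℤ) =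
      PowerSeries.mk (fun k => (-1 : ℤ) ^ k * ((n + k - 1).choose k : ℤ)) * (R : PowerSeries ℤ) := by
    rw [h]
    push_cast
    rw [← mul_assoc, mk_choose_mul_one_add_X_pow, one_mul]
  have h2 : D.coeff p = ∑ k ∈ Finset.range (p + 1),
      (-1 : ℤ) ^ k * ((n + k - 1).choose k : ℤ) * R.coeff (p - k) := by
    rw [← Polynomial.coeff_coe, h1, PowerSeries.coeff_mul,
      Finset.Nat.sum_antidiagonal_eq_sum_range_succ_mk]
    simp only [PowerSeries.coeff_mk, Polynomial.coeff_coe]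
  rw [Finset.sum_range_succ'] at h2
  simp only [pow_zero, Nat.choose_zero_right, Nat.cast_one, one_mul, Nat.sub_zero] at h2
  rw [h2]
  have h3 : ∑ k ∈ Finset.Icc 1 p, (-1) ^ (k - 1) * R.coeff (p - k) * binom ((n : ℤ) + k - 1) k =
      ∑ k ∈ Finset.range p,
        (-1) ^ k * R.coeff (p - (k + 1)) * binom ((n : ℤ) + (k + 1 : ℕ) - 1) (k + 1) := by
    refine (Finset.sum_nbij (fun k => k + 1) (fun k hk => ?_) (fun k _ l _ h => ?_)
      (fun k hk => ?_) (fun k _ => ?_)).symm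
    · simp only [Finset.mem_range, Finset.mem_Icc] at hk ⊢; omega
    · simpa using h
    · simp only [Finset.coe_Icc, Set.mem_Icc] at hk
      exact ⟨k - 1, by simp; omega, by simp; omega⟩
    · rw [Nat.add_sub_cancel]
  rw [h3, sub_add_eq_sub_sub_swap, sub_self, zero_sub, ← Finset.sum_neg_distrib]
  refine Finset.sum_congr rfl fun k _ => ?_
  rw [binom_natCast_add n (k + 1) (by omega) (by omega), pow_succ]
  ring

/-- The coefficients of `G` as a function of two exponents. -/
noncomputable def coeffs (G : ℤ[X][Y]) : ℕ × ℕ → ℤ := fun pq => (G.coeff pq.2).coeff pq.1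

theorem rowSum_eq {c : ℕ} {a₂ : ℤ} {G : ℤ[X][Y]} {q : ℕ} {D : ℤ[X]}
    (h : G.coeff q = (1 + X) ^ (a₂ - c * q).toNat * D) (p : ℕ) :
    ∑ k ∈ Finset.Icc 1 p,
      (-1) ^ (k - 1) * coeffs G (p - k, q) * binom (a₂ - (c : ℤ) * q + k - 1) k =
        coeffs G (p, q) - D.coeff p :=
  sum_binom_eq_sub h p

theorem colSum_eq {b : ℕ} {a₁ : ℤ} {G : ℤ[X][Y]} {p : ℕ} {D : ℤ[X]}
    (h : (swap G).coeff p = (1 + X) ^ (a₁ - b * p).toNat * D) (q : ℕ) :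
    ∑ k ∈ Finset.Icc 1 q,
      (-1) ^ (k - 1) * coeffs G (p, q - k) * binom (a₁ - (b : ℤ) * p + k - 1) k =
        coeffs G (p, q) - D.coeff q := by
  have := sum_binom_eq_sub h q
  simp only [coeff_coeff_swap] at this
  exact this

/-- Each sum falls short of the coefficient by a nonnegative coefficient of a quotient, and away
from the origin one of the two shortfalls is zero. -/
theorem IsRegional.greedyRecurrence {b c : ℕ} {a₁ a₂ : ℤ} {G : ℤ[X][Y]}
    (h : IsRegional b c a₁ a₂ G) (hp : IsPositive b c a₁ a₂ G) :
    GreedyRecurrence b c a₁ a₂ (coeffs G) := by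
  intro p q hpq
  obtain ⟨D, hD, hD'⟩ := h.row q
  obtain ⟨E, hE, hE'⟩ := h.col p
  rw [rowSum_eq hD, colSum_eq hE]
  have h1 := hp.row q D hD p
  have h2 := hp.col p E hE q
  rcases le_total ((c : ℤ) * q * a₁) (b * p * a₂) with h3 | h3
  · rw [hD' p hpq h3, sub_zero, max_eq_left (by linarith)]
  · rw [hE' q (fun h4 => hpq (by simp_all)) h3, sub_zero, max_eq_right (by linarith)]

theorem GreedyRecurrence.unique {b c : ℕ} {a₁ a₂ : ℤ} {f g : ℕ × ℕ → ℤ}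
    (hf : GreedyRecurrence b c a₁ a₂ f) (hg : GreedyRecurrence b c a₁ a₂ g)
    (h0 : f (0, 0) = g (0, 0)) : f = g := by
  suffices ∀ n p q, p + q = n → f (p, q) = g (p, q) from funext fun x => this _ x.1 x.2 rfl
  intro n
  induction n using Nat.strong_induction_on with
  | _ n ih =>
    intro p q hpq
    by_cases h : (p, q) = (0, 0)
    · rw [h, h0]
    · rw [hf p q h, hg p q h]
      congr 1
      · refine Finset.sum_congr rfl fun k hk => ?_
        have := Finset.mem_Icc.1 hk
        rw [ih (p - k + q) (by omega) _ _ rfl]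
      · refine Finset.sum_congr rfl fun k hk => ?_
        have := Finset.mem_Icc.1 hk
        rw [ih (p + (q - k)) (by omega) _ _ rfl]

/-- At each nonzero point the vanishing of a row or column quotient expresses the coefficient
through those with smaller `p + q`. Positivity plays no part, so it need not be followed through a
reflection. -/
theorem IsRegional.unique {b c : ℕ} {a₁ a₂ : ℤ} {G G' : ℤ[X][Y]}
    (h : IsRegional b c a₁ a₂ G) (h' : IsRegional b c a₁ a₂ G') : G = G' := by
  suffices ∀ n p q, p + q = n → coeffs G (p, q) = coeffs G' (p, q) by
    ext q p
    exact this _ p q rfl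
  intro n
  induction n using Nat.strong_induction_on with
  | _ n ih =>
    intro p q hpq
    by_cases h0 : (p, q) = (0, 0)
    · rw [h0]
      exact h.coeff_zero.trans h'.coeff_zero.symm
    rcases le_total ((c : ℤ) * q * a₁) (b * p * a₂) with h3 | h3
    · obtain ⟨D, hD, hD'⟩ := h.row q
      obtain ⟨E, hE, hE'⟩ := h'.row q
      have h1 := rowSum_eq hD p
      have h2 := rowSum_eq hE p
      rw [hD' p h0 h3, sub_zero] at h1
      rw [hE' p h0 h3, sub_zero] at h2
      rw [← h1, ← h2]
      refine Finset.sum_congr rfl fun k hk => ?_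
      have := Finset.mem_Icc.1 hk
      rw [ih (p - k + q) (by omega) _ _ rfl]
    · obtain ⟨D, hD, hD'⟩ := h.col p
      obtain ⟨E, hE, hE'⟩ := h'.col p
      have h0' : (q, p) ≠ (0, 0) := fun h4 => h0 (by simp_all)
      have h1 := colSum_eq hD q
      have h2 := colSum_eq hE q
      rw [hD' q h0' h3, sub_zero] at h1
      rw [hE' q h0' h3, sub_zero] at h2
      rw [← h1, ← h2]
      refine Finset.sum_congr rfl fun k hk => ?_
      have := Finset.mem_Icc.1 hk
      rw [ih (p + (q - k)) (by omega) _ _ rfl]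

/-! ### Existence of regional polynomials -/

theorem coeff_one_add_X_pow_nonneg (n k : ℕ) : 0 ≤ ((1 + X : ℤ[X]) ^ n).coeff k := by
  rw [coeff_one_add_X_pow]; positivity

theorem coeff_swap_C (f : ℤ[X]) (p : ℕ) : (swap (C f : ℤ[X][Y])).coeff p = C (f.coeff p) := by
  rw [Bivariate.swap_C, coeff_map]

/-- For `a₁ ≤ 0` no column has to be divisible, and the single row `q = 0` suffices. The
corresponding element is a power of `x₁` times a power of `x₂` or `x₀`. -/
theorem isRegional_of_nonpos {b c : ℕ} (hb : 0 < b) (a₁ a₂ : ℤ) (ha₁ : a₁ ≤ 0) :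
    IsRegional b c a₁ a₂ (C ((1 + X) ^ a₂.toNat)) := by
  refine ⟨by rw [coeff_C_zero, coeff_one_add_X_pow]; simp, fun q => ?_, fun p => ?_⟩
  · rcases Nat.eq_zero_or_pos q with rfl | hq
    · refine ⟨1, by rw [coeff_C_zero]; simp, fun p hp _ => ?_⟩
      rw [coeff_one, if_neg (by simpa using hp)]
    · exact ⟨0, by rw [coeff_C, if_neg hq.ne', mul_zero], by simp⟩
  · refine ⟨C (((1 + X : ℤ[X]) ^ a₂.toNat).coeff p), ?_, fun q hpq hle => ?_⟩
    · have : (b : ℤ) * p ≥ 0 := by positivity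
      rw [coeff_swap_C, Int.toNat_of_nonpos (show a₁ - b * p ≤ 0 by linarith), pow_zero, one_mul]
    · rw [coeff_C]
      split_ifs with hq
      · subst hq
        have hp : 0 < p := Nat.pos_of_ne_zero (by simpa using hpq)
        have h1 : a₂ ≤ 0 := by
          by_contra h
          have : (0 : ℤ) < b * p * a₂ := by
            have : (0 : ℤ) < a₂ := not_le.1 h
            positivity
          simp at hle
          linarith
        rw [Int.toNat_of_nonpos h1, pow_zero, coeff_one, if_neg hp.ne']
      · rfl

theorem isPositive_of_nonpos (b c : ℕ) (a₁ a₂ : ℤ) (ha₁ : a₁ ≤ 0) :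
    IsPositive b c a₁ a₂ (C ((1 + X) ^ a₂.toNat)) := by
  constructor
  · refine RowNonneg.of_factor (fun q => if q = 0 then 1 else 0) (fun q => ?_) (fun q p => ?_)
    · rw [coeff_C]
      split_ifs with h
      · simp [h]
      · simp
    · split_ifs
      · rw [coeff_one]; split_ifs <;> simp
      · simp
  · refine RowNonneg.of_factor (fun p => C (((1 + X : ℤ[X]) ^ a₂.toNat).coeff p)) (fun p => ?_)
      (fun p q => ?_)
    · have : (b : ℤ) * p ≥ 0 := by positivity
      rw [coeff_swap_C, Int.toNat_of_nonpos (show a₁ - b * p ≤ 0 by linarith), pow_zero, one_mul]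
    · rw [coeff_C]
      split_ifs
      · exact coeff_one_add_X_pow_nonneg _ _
      · rfl

theorem exists_isRegional {b c : ℕ} (hb : 0 < b) (hc : 0 < c) (a₁ a₂ : ℤ) :
    ∃ G : ℤ[X][Y], IsRegional b c a₁ a₂ G ∧ IsPositive b c a₁ a₂ G ∧
      ∀ q : ℕ, max a₁ 0 < q → G.coeff q = 0 := by
  rcases le_or_gt a₁ 0 with h1 | h1
  · refine ⟨_, isRegional_of_nonpos hb a₁ a₂ h1, isPositive_of_nonpos b c a₁ a₂ h1, fun q hq => ?_⟩
    rw [coeff_C, if_neg]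
    have := le_max_right a₁ 0
    omega
  rcases le_or_gt a₂ 0 with h2 | h2
  · refine ⟨_, (isRegional_of_nonpos hc a₂ a₁ h2).swap, (isPositive_of_nonpos c b a₂ a₁ h2).swap,
      fun q hq => ?_⟩
    rw [coeff_swap_C, coeff_one_add_X_pow, Nat.choose_eq_zero_of_lt, Nat.cast_zero, map_zero]
    have := le_max_left a₁ 0
    omega
  lift a₁ to ℕ using h1.le
  lift a₂ to ℕ using h2.le
  obtain ⟨G, hG, hG', hG''⟩ := exists_isRegional_of_pos hb hc (a₁ := a₁) (a₂ := a₂) (by omega)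
    (by omega)
  refine ⟨G, hG, hG', fun q hq => hG'' q ?_⟩
  have := le_max_left (a₁ : ℤ) 0
  omega

/-! ### Evaluation -/

theorem natDegree_lt_of_coeff_eq_zero {R : Type*} [Semiring R] {f : R[X]} {N : ℕ} (hN : 0 < N)
    (h : ∀ q, N ≤ q → f.coeff q = 0) : f.natDegree < N := by
  have : f.natDegree ≤ N - 1 :=
    natDegree_le_iff_coeff_eq_zero.2 fun q hq => h q (by omega)
  omega

/-- Evaluation of a bivariate polynomial with integer coefficients. -/
noncomputable def evalAt {K : Type*} [CommRing K] (t s : K) : ℤ[X][Y] →+* K :=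
  eval₂RingHom (eval₂RingHom (Int.castRingHom K) t) s

section Eval

variable {K : Type*} [CommRing K] (t s : K)

@[simp] theorem evalAt_C (f : ℤ[X]) : evalAt t s (C f) = eval₂ (Int.castRingHom K) t f := by
  simp [evalAt]

@[simp] theorem evalAt_Y : evalAt t s Y = s := by simp [evalAt]

theorem evalAt_swap (G : ℤ[X][Y]) : evalAt t s (Bivariate.swap G) = evalAt s t G := by
  induction G using Polynomial.induction_on' with
  | add f g hf hg => simp only [map_add, hf, hg]
  | monomial n f =>
    induction f using Polynomial.induction_on' with
    | add f g hf hg => simp only [map_add, hf, hg]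
    | monomial m r =>
      rw [Bivariate.swap_monomial_monomial]
      simp only [evalAt, coe_eval₂RingHom, eval₂_monomial]
      ring

theorem evalAt_eq_sum (G : ℤ[X][Y]) {N : ℕ} (hN : ∀ q, N ≤ q → G.coeff q = 0) :
    evalAt t s G = ∑ q ∈ Finset.range N, eval₂ (Int.castRingHom K) t (G.coeff q) * s ^ q := by
  rw [evalAt, coe_eval₂RingHom]
  rcases Nat.eq_zero_or_pos N with rfl | h
  · have : G = 0 := by ext1 q; rw [hN q (Nat.zero_le q), coeff_zero]
    simp [this]
  · rw [eval₂_eq_sum_range' _ (natDegree_lt_of_coeff_eq_zero h hN)]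
    rfl

end Eval

/-- The coefficients of `G` as a finitely supported function. -/
noncomputable def coeffsFinsupp (G : ℤ[X][Y]) : ℕ × ℕ →₀ ℤ :=
  Finsupp.onFinset (Finset.range ((Bivariate.swap G).natDegree + 1) ×ˢ
    Finset.range (G.natDegree + 1)) (coeffs G) (fun pq h => by
      rw [Finset.mem_product, Finset.mem_range, Finset.mem_range]
      constructor
      · by_contra h1
        apply h
        rw [coeffs, ← coeff_coeff_swap, coeff_eq_zero_of_natDegree_lt (p := Bivariate.swap G)
          (by omega), coeff_zero]
      · by_contra h1
        apply h
        rw [coeffs, coeff_eq_zero_of_natDegree_lt (p := G) (by omega), coeff_zero])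

/-- The Laurent polynomial with coefficients `G`, shifted to start at `x₁ ^ (-a₁) * x₂ ^ (-a₂)`. -/
noncomputable def laurent (b c : ℕ) (a₁ a₂ : ℤ) (G : ℤ[X][Y]) : Ambient :=
  x₁ ^ (-a₁) * x₂ ^ (-a₂) * evalAt (x₁ ^ b) (x₂ ^ c) G

theorem pointedSum_coeffsFinsupp (b c : ℕ) (a₁ a₂ : ℤ) (G : ℤ[X][Y]) :
    pointedSum b c a₁ a₂ (coeffsFinsupp G) = laurent b c a₁ a₂ G := by
  rw [pointedSum, laurent]
  congr 1
  rw [coeffsFinsupp, Finsupp.onFinset_sum _ (fun _ => by simp), Finset.sum_product_right,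
    evalAt_eq_sum (N := G.natDegree + 1) _ _ G
      (fun q hq => coeff_eq_zero_of_natDegree_lt (by omega))]
  refine Finset.sum_congr rfl fun q _ => ?_
  rw [eval₂_eq_sum_range' (n := (Bivariate.swap G).natDegree + 1), Finset.sum_mul]
  · refine Finset.sum_congr rfl fun p _ => ?_
    simp [coeffs, pow_mul]
  · refine natDegree_lt_of_coeff_eq_zero (Nat.succ_pos _) fun p hp => ?_
    rw [← coeff_coeff_swap, coeff_eq_zero_of_natDegree_lt (p := Bivariate.swap G) (by omega),
      coeff_zero]

theorem IsRegional.isGreedyAt {b c : ℕ} {a₁ a₂ : ℤ} {G : ℤ[X][Y]}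
    (h : IsRegional b c a₁ a₂ G) (hp : IsPositive b c a₁ a₂ G) {z : clusterAlgebra b c}
    (hz : (z : Ambient) = laurent b c a₁ a₂ G) : IsGreedyAt b c a₁ a₂ z :=
  ⟨coeffsFinsupp G, ⟨h.coeff_zero, by rw [hz, pointedSum_coeffsFinsupp]⟩,
    h.greedyRecurrence hp⟩

theorem IsRegional.eq_laurent_of_isGreedyAt {b c : ℕ} {a₁ a₂ : ℤ} {G : ℤ[X][Y]}
    (h : IsRegional b c a₁ a₂ G) (hp : IsPositive b c a₁ a₂ G) {z : clusterAlgebra b c}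
    (hz : IsGreedyAt b c a₁ a₂ z) : (z : Ambient) = laurent b c a₁ a₂ G := by
  obtain ⟨coef, ⟨h1, h2⟩, h3⟩ := hz
  have : coef = coeffsFinsupp G := DFunLike.coe_injective
    (h3.unique (h.greedyRecurrence hp) (h1.trans h.coeff_zero.symm))
  rw [h2, this, pointedSum_coeffsFinsupp]

end RankTwo

namespace RankTwo

open Polynomial Polynomial.Bivariate

/-! ### Cluster variables -/

theorem clusterVar_ne_zero (b c : ℕ) (m : ℤ) : clusterVar b c m ≠ 0 := by
  rw [clusterVar]
  split_ifs
  · exact (posAtOne_forward b c _).1.ne_zero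
  · exact (posAtOne_backward b c _).2.ne_zero

theorem x₁_ne_zero : x₁ ≠ 0 := posAtOne_x₁.ne_zero

theorem x₂_ne_zero : x₂ ≠ 0 := posAtOne_x₂.ne_zero

theorem clusterVar_zero_mul (b c : ℕ) : clusterVar b c 0 * x₂ = x₁ ^ b + 1 := by
  have := exchange_relation b c 1
  simpa [clusterVar_one, clusterVar_two] using this

theorem mul_clusterVar_three (b c : ℕ) : x₁ * clusterVar b c 3 = x₂ ^ c + 1 := by
  have := exchange_relation b c 2
  norm_num [clusterVar_one, clusterVar_two] at this
  simpa [show ¬ Odd (2 : ℤ) by decide] using this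

theorem clusterVar_mem (b c : ℕ) (m : ℤ) : clusterVar b c m ∈ clusterAlgebra b c :=
  Subring.subset_closure ⟨m, rfl⟩

theorem x₁_mem (b c : ℕ) : x₁ ∈ clusterAlgebra b c := by
  rw [← clusterVar_one b c]; exact clusterVar_mem b c 1

theorem x₂_mem (b c : ℕ) : x₂ ∈ clusterAlgebra b c := by
  rw [← clusterVar_two b c]; exact clusterVar_mem b c 2

/-- A subring containing four consecutive cluster variables contains the next one. -/
theorem mem_of_exchange {K : Type*} [Field K] (R : Subring K) {y₀ y₁ y₂ y₃ y₄ : K} {e f : ℕ}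
    (hf : 0 < f) (h₁ : y₀ * y₂ = y₁ ^ e + 1) (h₂ : y₁ * y₃ = y₂ ^ f + 1)
    (h₃ : y₂ * y₄ = y₃ ^ e + 1) (h0 : y₂ ≠ 0) (hy₀ : y₀ ∈ R) (hy₂ : y₂ ∈ R) (hy₃ : y₃ ∈ R) :
    y₄ ∈ R := by
  obtain ⟨Q, hQ⟩ : (⟨y₂, hy₂⟩ : R) ∣ (⟨y₂, hy₂⟩ ^ f + 1) ^ e - 1 := by
    have h := sub_dvd_pow_sub_pow ((⟨y₂, hy₂⟩ : R) ^ f + 1) 1 e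
    rw [add_sub_cancel_right, one_pow] at h
    exact (dvd_pow_self _ hf.ne').trans h
  have hQ' : (y₂ ^ f + 1) ^ e - 1 = y₂ * Q := by
    have := congrArg (Subring.subtype R) hQ
    simpa using this
  -- Multiply by `y₂`: `y₀ y₂ y₃^e = (y₁ y₃)^e + y₃^e`, where `(y₁ y₃)^e = 1 + y₂ Q` and `y₃^e + 1 =
  -- y₂ y₄`.
  have : y₄ = y₀ * y₃ ^ e - Q := by
    apply mul_left_cancel₀ h0
    rw [mul_sub, ← hQ', ← h₂, mul_pow, h₃]
    linear_combination (-(y₃ ^ e)) * h₁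
  rw [this]
  exact R.sub_mem (R.mul_mem hy₀ (R.pow_mem hy₃ e)) Q.2

/-- A subring containing `x₀, x₁, x₂, x₃` contains the cluster algebra. -/
theorem clusterAlgebra_le {b c : ℕ} (hb : 0 < b) (hc : 0 < c) (R : Subring Ambient)
    (h₀ : clusterVar b c 0 ∈ R) (h₁ : x₁ ∈ R) (h₂ : x₂ ∈ R) (h₃ : clusterVar b c 3 ∈ R) :
    clusterAlgebra b c ≤ R := by
  rw [clusterAlgebra, Subring.closure_le]
  rintro _ ⟨m, rfl⟩
  have hexp : ∀ m : ℤ, 0 < if Odd m then b else c := fun m => by split_ifs <;> assumption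
  have hodd : ∀ m : ℤ, (if Odd (m + 2) then b else c) = if Odd m then b else c := fun m => by
    have : Odd (m + 2) ↔ Odd m := by simp [parity_simps]
    simp [this]
  suffices ∀ k : ℤ, clusterVar b c k ∈ R ∧ clusterVar b c (k + 1) ∈ R ∧
      clusterVar b c (k + 2) ∈ R ∧ clusterVar b c (k + 3) ∈ R from (this m).1
  intro k
  induction k using Int.induction_on with
  | zero => exact ⟨h₀, by simpa [clusterVar_one], by simpa [clusterVar_two], by simpa⟩
  | succ i ih =>
    obtain ⟨g0, g1, g2, g3⟩ := ih
    refine ⟨g1, by ring_nf at g2 ⊢; exact g2, by ring_nf at g3 ⊢; exact g3, ?_⟩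
    have e1 := exchange_relation b c (i + 1)
    have e2 := exchange_relation b c (i + 2)
    have e3 := exchange_relation b c (i + 3)
    rw [show (i : ℤ) + 3 = i + 1 + 2 by ring, hodd] at e3
    exact mem_of_exchange R (hexp (i + 2)) (y₀ := clusterVar b c i) (y₁ := clusterVar b c (i + 1))
      (y₂ := clusterVar b c (i + 2)) (y₃ := clusterVar b c (i + 3))
      (by convert e1 using 3 <;> ring) (by convert e2 using 3 <;> ring)
      (by convert e3 using 3 <;> ring_nf) (clusterVar_ne_zero _ _ _) g0 g2 g3
  | pred i ih =>
    obtain ⟨g0, g1, g2, g3⟩ := ih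
    refine ⟨?_, by convert g0 using 2; ring, by convert g1 using 2; ring,
      by convert g2 using 2; ring⟩
    have e1 := exchange_relation b c (-i + 2)
    have e2 := exchange_relation b c (-i + 1)
    have e3 := exchange_relation b c (-i)
    rw [hodd] at e1
    exact mem_of_exchange R (hexp (-i + 1)) (y₀ := clusterVar b c (-i + 3))
      (y₁ := clusterVar b c (-i + 2)) (y₂ := clusterVar b c (-i + 1)) (y₃ := clusterVar b c (-i))
      (by rw [mul_comm]; convert e1 using 3 <;> ring)
      (by rw [mul_comm]; convert e2 using 3 <;> ring)
      (by rw [mul_comm]; convert e3 using 3) (clusterVar_ne_zero _ _ _) g3 g1 g0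

/-! ### Algebraic independence -/

theorem aevalAeval_injective_iff {A : Type*} [CommRing A] [Algebra ℚ A] (x y : A) :
    Function.Injective (aevalAeval x y : ℚ[X][Y] →ₐ[ℚ] A) ↔
      Function.Injective (MvPolynomial.aeval ![x, y] : MvPolynomial (Fin 2) ℚ →ₐ[ℚ] A) := by
  have h : (aevalAeval x y : ℚ[X][Y] →ₐ[ℚ] A) =
      (MvPolynomial.aeval ![x, y]).comp (equivMvPolynomial ℚ).toAlgHom := by
    ext <;> simp
  have h' : ⇑(aevalAeval x y : ℚ[X][Y] →ₐ[ℚ] A) =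
      (MvPolynomial.aeval ![x, y] : MvPolynomial (Fin 2) ℚ →ₐ[ℚ] A) ∘ equivMvPolynomial ℚ :=
    congrArg DFunLike.coe h
  rw [h', EquivLike.injective_comp]

theorem aeval_x₁_x₂ : (MvPolynomial.aeval ![x₁, x₂] : MvPolynomial (Fin 2) ℚ →ₐ[ℚ] Ambient) =
    Algebra.algHom ℚ (MvPolynomial (Fin 2) ℚ) Ambient := by
  ext i
  fin_cases i <;> simp [x₁, x₂, Algebra.algHom]

theorem aevalAeval_x₁_x₂_injective :
    Function.Injective (aevalAeval x₁ x₂ : ℚ[X][Y] →ₐ[ℚ] Ambient) := by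
  rw [aevalAeval_injective_iff, aeval_x₁_x₂]
  exact IsFractionRing.injective (MvPolynomial (Fin 2) ℚ) Ambient

/-- If `t` and `s` are algebraically independent, so are `t` and `u(t) / s`. -/
theorem aevalAeval_div_injective {K : Type*} [Field K] [Algebra ℚ K] {t s : K}
    (h : Function.Injective (aevalAeval t s : ℚ[X][Y] →ₐ[ℚ] K)) (hs : s ≠ 0) {U : ℚ[X]}
    (hU : U ≠ 0) :
    Function.Injective (aevalAeval t (aeval t U / s) : ℚ[X][Y] →ₐ[ℚ] K) := by
  rw [injective_iff_map_eq_zero]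
  intro f hf
  set N := f.natDegree with hN
  have expand : ∀ (y : K) (g : ℚ[X][Y]) (M : ℕ), g.natDegree < M →
      aevalAeval t y g = ∑ q ∈ Finset.range M, aeval t (g.coeff q) * y ^ q := by
    intro y g M hM
    conv_lhs => rw [g.as_sum_range' M hM]
    simp [map_sum, ← C_mul_X_pow_eq_monomial]
  -- Clearing denominators with `s^N` turns a relation between `t` and `u(t)/s` into one between `t`
  -- and `s`.
  have h1 : aevalAeval t s (∑ q ∈ Finset.range (N + 1), C (f.coeff q * U ^ q) * Y ^ (N - q)) =
      aevalAeval t (aeval t U / s) f * s ^ N := by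
    rw [expand _ f (N + 1) (by omega), Finset.sum_mul, map_sum]
    refine Finset.sum_congr rfl fun q hq => ?_
    have hq' : N = N - q + q := by have := Finset.mem_range.1 hq; omega
    have hs' : s ^ N = s ^ (N - q) * s ^ q := by rw [← pow_add, ← hq']
    rw [hs', div_pow]
    simp
    field_simp
  rw [hf, zero_mul] at h1
  have h2 := h (h1.trans (map_zero _).symm)
  ext1 q
  rcases le_or_gt q N with hq | hq
  · have h3 := congrArg (fun g => coeff g (N - q)) h2
    simp only [finsetSum_coeff, coeff_C_mul, coeff_X_pow, coeff_zero, mul_ite, mul_one,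
      mul_zero] at h3
    rw [Finset.sum_eq_single q] at h3
    · rw [if_pos rfl] at h3
      rw [coeff_zero]
      exact (mul_eq_zero.1 h3).resolve_right (pow_ne_zero _ hU)
    · intro r hr hrq
      rw [if_neg]
      have := Finset.mem_range.1 hr
      omega
    · intro h; exact absurd (Finset.mem_range.2 (by omega)) h
  · rw [coeff_eq_zero_of_natDegree_lt hq, coeff_zero]

/-- Algebraically independent elements define an endomorphism of the field of rational functions. -/
theorem exists_ringHom {u v : Ambient}
    (h : Function.Injective (aevalAeval u v : ℚ[X][Y] →ₐ[ℚ] Ambient)) :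
    ∃ σ : Ambient →+* Ambient, σ x₁ = u ∧ σ x₂ = v := by
  refine ⟨IsFractionRing.lift (A := MvPolynomial (Fin 2) ℚ)
    (g := (MvPolynomial.aeval ![u, v] : MvPolynomial (Fin 2) ℚ →ₐ[ℚ] Ambient).toRingHom)
    ((aevalAeval_injective_iff u v).1 h), ?_, ?_⟩
  · rw [x₁, IsFractionRing.lift_algebraMap]; simp
  · rw [x₂, IsFractionRing.lift_algebraMap]; simp

theorem evalAt_injective : Function.Injective (evalAt x₁ x₂) := by
  have h : ∀ G : ℤ[X][Y], evalAt x₁ x₂ G =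
      aevalAeval x₁ x₂ (G.map (mapRingHom (Int.castRingHom ℚ))) := by
    intro G
    have : evalAt x₁ x₂ = ((aevalAeval x₁ x₂ : ℚ[X][Y] →ₐ[ℚ] Ambient) : ℚ[X][Y] →+* Ambient).comp
        (mapRingHom (mapRingHom (Int.castRingHom ℚ))) := by
      ext <;> simp
    rw [this]
    rfl
  intro f g hfg
  rw [h, h] at hfg
  exact map_injective _ (map_injective _ Int.cast_injective) (aevalAeval_x₁_x₂_injective hfg)

/-! ### Reflections -/

/-- A ring homomorphism that reverses the order of two adjacent cluster variables reverses the
order of all of them. -/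
theorem map_clusterVar {b c b' c' : ℕ} {s : ℤ} (σ : Ambient →+* Ambient)
    (hexp : ∀ m : ℤ, (if Odd m then b else c) = if Odd (s - m) then b' else c')
    (h₁ : σ x₁ = clusterVar b' c' (s - 1)) (h₂ : σ x₂ = clusterVar b' c' (s - 2)) (m : ℤ) :
    σ (clusterVar b c m) = clusterVar b' c' (s - m) := by
  suffices ∀ k : ℤ, σ (clusterVar b c (1 + k)) = clusterVar b' c' (s - (1 + k)) ∧
      σ (clusterVar b c (2 + k)) = clusterVar b' c' (s - (2 + k)) by
    have := (this (m - 1)).1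
    rwa [add_sub_cancel] at this
  have hmap : ∀ k : ℤ, σ (clusterVar b c (k - 1)) * σ (clusterVar b c (k + 1)) =
      σ (clusterVar b c k) ^ (if Odd (s - k) then b' else c') + 1 := fun k => by
    rw [← map_mul, exchange_relation, map_add, map_one, map_pow, hexp]
  intro k
  induction k using Int.induction_on with
  | zero => simpa [clusterVar_one, clusterVar_two] using ⟨h₁, h₂⟩
  | succ i ih =>
    obtain ⟨g1, g2⟩ := ih
    refine ⟨by convert g2 using 3 <;> ring, ?_⟩
    have h := hmap (2 + i)
    rw [g2, ← exchange_relation, show (2 + i - 1 : ℤ) = 1 + i by ring, g1, mul_comm,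
      show s - (2 + (i : ℤ)) + 1 = s - (1 + i) by ring] at h
    have := mul_right_cancel₀ (clusterVar_ne_zero _ _ _) h
    rw [show 2 + ((i : ℤ) + 1) = 2 + i + 1 by ring, this]
    congr 1
    ring
  | pred i ih =>
    obtain ⟨g1, g2⟩ := ih
    refine ⟨?_, by convert g1 using 3 <;> ring⟩
    have h := hmap (1 + -i)
    rw [g1, ← exchange_relation, show (1 + -i + 1 : ℤ) = 2 + -i by ring, g2, mul_comm,
      show s - (1 + -(i : ℤ)) - 1 = s - (2 + -i) by ring] at h
    have := mul_left_cancel₀ (clusterVar_ne_zero _ _ _) h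
    rw [show 1 + (-(i : ℤ) - 1) = 1 + -i - 1 by ring, this]
    congr 1
    ring

theorem map_mem_clusterAlgebra {b c b' c' : ℕ} {s : ℤ} {σ : Ambient →+* Ambient}
    (h : ∀ m, σ (clusterVar b c m) = clusterVar b' c' (s - m)) {z : Ambient}
    (hz : z ∈ clusterAlgebra b c) : σ z ∈ clusterAlgebra b' c' := by
  have : clusterAlgebra b c ≤ (clusterAlgebra b' c').comap σ := by
    rw [clusterAlgebra, Subring.closure_le]
    rintro _ ⟨m, rfl⟩
    rw [SetLike.mem_coe, Subring.mem_comap, h]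
    exact clusterVar_mem _ _ _
  exact this hz

/-- The reflection of the cluster variables that fixes `x₁`. -/
theorem exists_reflection_one {b c : ℕ} :
    ∃ σ : Ambient →+* Ambient, σ x₁ = x₁ ∧ σ x₂ = clusterVar b c 0 ∧
      ∀ m, σ (clusterVar b c m) = clusterVar b c (2 - m) := by
  have hU : (X ^ b + 1 : ℚ[X]) ≠ 0 := by
    intro h
    have := congrArg (eval 1) h
    norm_num at this
  obtain ⟨σ, h1, h2⟩ := exists_ringHom
    (aevalAeval_div_injective aevalAeval_x₁_x₂_injective x₂_ne_zero hU)
  have h3 : aeval x₁ (X ^ b + 1 : ℚ[X]) / x₂ = clusterVar b c 0 := by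
    rw [div_eq_iff x₂_ne_zero, clusterVar_zero_mul]; simp
  rw [h3] at h2
  refine ⟨σ, h1, h2, map_clusterVar σ (fun m => ?_) (by simpa [clusterVar_one]) (by simpa)⟩
  have : Odd (2 - m) ↔ Odd m := by
    rw [Int.odd_sub]
    simp [show ¬ Odd (2 : ℤ) by decide]
  simp [this]

/-- The exchange of `x₁` and `x₂`. -/
theorem exists_flip :
    ∃ θ : Ambient →+* Ambient, θ x₁ = x₂ ∧ θ x₂ = x₁ ∧
      ∀ (b c : ℕ) (m : ℤ), θ (clusterVar b c m) = clusterVar c b (3 - m) := by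
  obtain ⟨θ, h1, h2⟩ := exists_ringHom (u := x₂) (v := x₁) (fun f g hfg => by
    rw [← Bivariate.aevalAeval_swap, ← Bivariate.aevalAeval_swap x₁ x₂ g] at hfg
    exact swap.injective (aevalAeval_x₁_x₂_injective hfg))
  refine ⟨θ, h1, h2, fun b c => map_clusterVar θ (fun m => ?_) (by simpa [clusterVar_two])
    (by simpa [clusterVar_one])⟩
  have : Odd (3 - m) ↔ ¬ Odd m := by
    rw [Int.odd_sub]
    simp [show Odd (3 : ℤ) by decide]
  by_cases h : Odd m <;> simp [this, h]

/-! ### The Laurent phenomenon -/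

/-- Elements with a monomial denominator form a subring, and by `clusterAlgebra_le` only `x₀, x₁,
x₂, x₃` have to be checked. -/
theorem exists_mul_pow_eq_evalAt {b c : ℕ} (hb : 0 < b) (hc : 0 < c) {z : Ambient}
    (hz : z ∈ clusterAlgebra b c) :
    ∃ (N : ℕ) (f : ℤ[X][Y]), z * (x₁ * x₂) ^ N = evalAt x₁ x₂ f := by
  have hx : evalAt x₁ x₂ (C X * Y) = x₁ * x₂ := by simp
  let R : Subring Ambient :=
    { carrier := {z | ∃ (N : ℕ) (f : ℤ[X][Y]), z * (x₁ * x₂) ^ N = evalAt x₁ x₂ f}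
      mul_mem' := by
        rintro y z ⟨N, f, hf⟩ ⟨M, g, hg⟩
        refine ⟨N + M, f * g, ?_⟩
        rw [map_mul, ← hf, ← hg]
        ring
      one_mem' := ⟨0, 1, by simp⟩
      add_mem' := by
        rintro y z ⟨N, f, hf⟩ ⟨M, g, hg⟩
        refine ⟨N + M, f * (C X * Y) ^ M + g * (C X * Y) ^ N, ?_⟩
        rw [map_add, map_mul, map_mul, map_pow, map_pow, ← hf, ← hg, hx]
        ring
      zero_mem' := ⟨0, 0, by simp⟩
      neg_mem' := by
        rintro y ⟨N, f, hf⟩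
        exact ⟨N, -f, by rw [map_neg, ← hf]; ring⟩ }
  refine clusterAlgebra_le hb hc R ⟨1, (C X) ^ (b + 1) + C X, ?_⟩ ⟨0, C X, by simp⟩
    ⟨0, Y, by simp⟩ ⟨1, Y ^ (c + 1) + Y, ?_⟩ hz
  · calc clusterVar b c 0 * (x₁ * x₂) ^ 1 = clusterVar b c 0 * x₂ * x₁ := by ring
      _ = _ := by rw [clusterVar_zero_mul]; simp; ring
  · calc clusterVar b c 3 * (x₁ * x₂) ^ 1 = x₁ * clusterVar b c 3 * x₂ := by ring
      _ = _ := by rw [mul_clusterVar_three]; simp; ring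

end RankTwo

namespace RankTwo

open Polynomial Polynomial.Bivariate

/-! ### Divisibility of rows and columns, and membership in the cluster algebra -/

/-- The rows of `G` are divisible by powers of `1 + X`. -/
def RowDvd (c : ℕ) (a₂ : ℤ) (G : ℤ[X][Y]) : Prop :=
  ∀ q : ℕ, (1 + X) ^ (a₂ - c * q).toNat ∣ G.coeff q

theorem RowFactor.rowDvd {b c : ℕ} {a₁ a₂ : ℤ} {G : ℤ[X][Y]} (h : RowFactor b c a₁ a₂ G) :
    RowDvd c a₂ G := fun q => by
  obtain ⟨D, hD, -⟩ := h q
  exact ⟨D, hD⟩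

theorem RowDvd.sub {c : ℕ} {a₂ : ℤ} {F G : ℤ[X][Y]} (hF : RowDvd c a₂ F) (hG : RowDvd c a₂ G) :
    RowDvd c a₂ (F - G) := fun q => by
  rw [coeff_sub]; exact dvd_sub (hF q) (hG q)

theorem RowDvd.sum {c : ℕ} {a₂ : ℤ} {ι : Type*} (s : Finset ι) {F : ι → ℤ[X][Y]}
    (hF : ∀ i ∈ s, RowDvd c a₂ (F i)) : RowDvd c a₂ (∑ i ∈ s, F i) := fun q => by
  rw [finsetSum_coeff]; exact Finset.dvd_sum fun i hi => hF i hi q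

theorem eval₂_one_add_X_pow {K : Type*} [CommRing K] (t : K) (n : ℕ) :
    eval₂ (Int.castRingHom K) t ((1 + X) ^ n) = (1 + t) ^ n := by
  rw [eval₂_pow, eval₂_add, eval₂_one, eval₂_X]

theorem zpow_neg_sub_mul {K : Type*} [Field K] {x : K} (hx : x ≠ 0) (a : ℤ) (b p : ℕ) :
    x ^ (-(a - b * p)) = x ^ (-a) * (x ^ b) ^ p := by
  rw [neg_sub, sub_eq_neg_add, zpow_add₀ hx, zpow_mul, zpow_natCast, zpow_natCast]

theorem one_add_x₁_pow (b c : ℕ) : 1 + x₁ ^ b = clusterVar b c 0 * x₂ := by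
  rw [clusterVar_zero_mul, add_comm]

theorem one_add_x₂_pow (b c : ℕ) : 1 + x₂ ^ c = x₁ * clusterVar b c 3 := by
  rw [mul_clusterVar_three, add_comm]

theorem zpow_mul_pow_toNat {K : Type*} [Field K] {x : K} (hx : x ≠ 0) (y : K) (m : ℤ) :
    x ^ (-m) * (x * y) ^ m.toNat = if m ≤ 0 then x ^ (-m).toNat else y ^ m.toNat := by
  split_ifs with h
  · rw [Int.toNat_of_nonpos h, pow_zero, mul_one, ← zpow_natCast, Int.toNat_of_nonneg (by omega)]
  · rw [mul_pow, ← mul_assoc, ← zpow_natCast, Int.toNat_of_nonneg (by omega), ← zpow_add₀ hx,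
      neg_add_cancel, zpow_zero, one_mul, ← zpow_natCast, Int.toNat_of_nonneg (by omega)]

theorem zpow_x₁_mul_mem (b c : ℕ) (m : ℤ) :
    x₁ ^ (-m) * (1 + x₂ ^ c) ^ m.toNat ∈ clusterAlgebra b c := by
  rw [one_add_x₂_pow b c, zpow_mul_pow_toNat x₁_ne_zero]
  split_ifs
  · exact Subring.pow_mem _ (x₁_mem b c) _
  · exact Subring.pow_mem _ (clusterVar_mem b c 3) _

theorem zpow_x₂_mul_mem (b c : ℕ) (m : ℤ) :
    x₂ ^ (-m) * (1 + x₁ ^ b) ^ m.toNat ∈ clusterAlgebra b c := by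
  rw [one_add_x₁_pow b c, mul_comm (clusterVar b c 0), zpow_mul_pow_toNat x₂_ne_zero]
  split_ifs
  · exact Subring.pow_mem _ (x₂_mem b c) _
  · exact Subring.pow_mem _ (clusterVar_mem b c 0) _

theorem eval₂_mem {K : Type*} [CommRing K] (R : Subring K) {t : K} (ht : t ∈ R) (f : ℤ[X]) :
    eval₂ (Int.castRingHom K) t f ∈ R := by
  rw [eval₂_eq_sum_range]
  refine Subring.sum_mem _ fun i _ => Subring.mul_mem _ ?_ (Subring.pow_mem _ ht _)
  simp

/-- The product of `t ^ p (1 + t) ^ (a₂ - c Q)₊` and `s ^ Q (1 + s) ^ (a₁ - b p)₊`. -/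
noncomputable def corner (b c : ℕ) (a₁ a₂ : ℤ) (p Q : ℕ) : ℤ[X][Y] :=
  C (X ^ p * (1 + X) ^ (a₂ - c * Q).toNat) * (Y ^ Q * (1 + Y) ^ (a₁ - b * p).toNat)

theorem swap_corner (b c : ℕ) (a₁ a₂ : ℤ) (p Q : ℕ) :
    Bivariate.swap (corner b c a₁ a₂ p Q) = corner c b a₂ a₁ Q p := by
  simp only [corner, map_mul, map_pow, map_add, map_one, Bivariate.swap_X, Bivariate.swap_Y]
  ring

theorem coeff_corner_of_lt (b c : ℕ) (a₁ a₂ : ℤ) (p Q : ℕ) {q : ℕ} (hq : q < Q) :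
    (corner b c a₁ a₂ p Q).coeff q = 0 := by
  rw [corner, coeff_C_mul, coeff_X_pow_mul', if_neg (by omega), mul_zero]

theorem coeff_corner_self (b c : ℕ) (a₁ a₂ : ℤ) (p Q : ℕ) :
    (corner b c a₁ a₂ p Q).coeff Q = X ^ p * (1 + X) ^ (a₂ - c * Q).toNat := by
  rw [corner, coeff_C_mul, coeff_X_pow_mul', if_pos le_rfl, Nat.sub_self, coeff_one_add_X_pow]
  simp

theorem rowDvd_corner (b c : ℕ) (a₁ a₂ : ℤ) (p Q : ℕ) : RowDvd c a₂ (corner b c a₁ a₂ p Q) := by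
  intro q
  rcases lt_or_ge q Q with hq | hq
  · rw [coeff_corner_of_lt _ _ _ _ _ _ hq]; exact dvd_zero _
  · rw [corner, coeff_C_mul]
    refine ((pow_dvd_pow _ ?_).mul_left _).mul_right _
    have : (c : ℤ) * Q ≤ c * q := by gcongr
    omega

/-- The element is a product of a power of `x₁` or `x₃` with a power of `x₂` or `x₀`. -/
theorem laurent_corner_mem (b c : ℕ) (a₁ a₂ : ℤ) (p Q : ℕ) :
    laurent b c a₁ a₂ (corner b c a₁ a₂ p Q) ∈ clusterAlgebra b c := by
  have h : laurent b c a₁ a₂ (corner b c a₁ a₂ p Q) =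
      (x₁ ^ (-(a₁ - b * p)) * (1 + x₂ ^ c) ^ (a₁ - b * p).toNat) *
        (x₂ ^ (-(a₂ - c * Q)) * (1 + x₁ ^ b) ^ (a₂ - c * Q).toNat) := by
    rw [laurent, corner]
    simp only [map_mul, map_pow, map_add, map_one, evalAt_Y, evalAt_C, eval₂_X]
    rw [zpow_neg_sub_mul x₁_ne_zero, zpow_neg_sub_mul x₂_ne_zero]
    ring
  rw [h]
  exact Subring.mul_mem _ (zpow_x₁_mul_mem _ _ _) (zpow_x₂_mul_mem _ _ _)

theorem laurent_sub (b c : ℕ) (a₁ a₂ : ℤ) (F G : ℤ[X][Y]) :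
    laurent b c a₁ a₂ (F - G) = laurent b c a₁ a₂ F - laurent b c a₁ a₂ G := by
  rw [laurent, laurent, laurent, map_sub, mul_sub]

theorem laurent_sum_smul (b c : ℕ) (a₁ a₂ : ℤ) {ι : Type*} (s : Finset ι) (d : ι → ℤ)
    (F : ι → ℤ[X][Y]) : laurent b c a₁ a₂ (∑ i ∈ s, d i • F i) =
      ∑ i ∈ s, d i • laurent b c a₁ a₂ (F i) := by
  simp only [laurent, map_sum, map_zsmul, Finset.mul_sum, mul_smul_comm]

theorem isCoprime_X_pow_one_add_X_pow (k n b : ℕ) (hb : 0 < b) :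
    IsCoprime ((X : ℤ[X]) ^ k) ((1 + X ^ b) ^ n) := by
  refine IsCoprime.pow ⟨-X ^ (b - 1), 1, ?_⟩
  obtain ⟨b, rfl⟩ := Nat.exists_eq_succ_of_ne_zero hb.ne'
  simp [pow_succ]

/-- Laurent polynomials with divisible rows and columns are in the cluster algebra. -/
theorem laurent_mem {b c : ℕ} (hc : 0 < c) {a₁ a₂ : ℤ} {G : ℤ[X][Y]} (hrow : RowDvd c a₂ G)
    (hcol : RowDvd b a₁ (Bivariate.swap G)) : laurent b c a₁ a₂ G ∈ clusterAlgebra b c := by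
  -- The rows are cleared one by one, `Q` being the number already cleared. Once `Q` reaches
  -- `a₂.toNat`, the factor `x₂ ^ (c Q)` absorbs `x₂ ^ (-a₂)`, and divisibility of the columns
  -- finishes the proof.
  suffices ∀ j Q : ℕ, a₂.toNat ≤ Q + j → ∀ G : ℤ[X][Y], RowDvd c a₂ G →
      RowDvd b a₁ (Bivariate.swap G) → (∀ q < Q, G.coeff q = 0) →
        laurent b c a₁ a₂ G ∈ clusterAlgebra b c from
    this a₂.toNat 0 (by omega) G hrow hcol (fun q hq => absurd hq (Nat.not_lt_zero q))
  intro j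
  induction j with
  | zero =>
    intro Q hQ G _ hcol hzero
    have hcQ : a₂ ≤ c * Q := by
      have h1 : (Q : ℤ) ≤ c * Q := by
        have : (1 : ℤ) ≤ c := by exact_mod_cast hc
        nlinarith
      omega
    rw [laurent, ← evalAt_swap, evalAt_eq_sum (N := (Bivariate.swap G).natDegree + 1) _ _ _
      (fun q hq => coeff_eq_zero_of_natDegree_lt (by omega)), Finset.mul_sum]
    refine Subring.sum_mem _ fun p _ => ?_
    obtain ⟨E, hE⟩ := hcol p
    have h1 : X ^ Q ∣ E := by
      have h2 : X ^ Q ∣ (Bivariate.swap G).coeff p := X_pow_dvd_iff.2 fun q hq => by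
        rw [coeff_coeff_swap, hzero q hq, coeff_zero]
      rw [hE] at h2
      have := isCoprime_X_pow_one_add_X_pow Q (a₁ - b * p).toNat 1 one_pos
      rw [pow_one] at this
      exact this.dvd_of_dvd_mul_left h2
    obtain ⟨E', rfl⟩ := h1
    have h3 : x₁ ^ (-a₁) * x₂ ^ (-a₂) *
        (eval₂ (Int.castRingHom Ambient) (x₂ ^ c) ((Bivariate.swap G).coeff p) * (x₁ ^ b) ^ p) =
          (x₁ ^ (-(a₁ - b * p)) * (1 + x₂ ^ c) ^ (a₁ - b * p).toNat) *
            x₂ ^ (c * Q - a₂).toNat * eval₂ (Int.castRingHom Ambient) (x₂ ^ c) E' := by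
      rw [hE, eval₂_mul, eval₂_mul, eval₂_one_add_X_pow, eval₂_pow, eval₂_X,
        ← zpow_natCast x₂ (c * Q - a₂).toNat, Int.toNat_of_nonneg (by omega),
        ← neg_sub a₂, zpow_neg_sub_mul x₁_ne_zero, zpow_neg_sub_mul x₂_ne_zero]
      ring
    rw [h3]
    exact Subring.mul_mem _ (Subring.mul_mem _ (zpow_x₁_mul_mem _ _ _)
      (Subring.pow_mem _ (x₂_mem b c) _)) (eval₂_mem _ (Subring.pow_mem _ (x₂_mem b c) _) _)
  | succ j ih =>
    intro Q hQ G hrow hcol hzero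
    obtain ⟨D, hD⟩ := hrow Q
    -- A combination of corners that has the same row `Q` as `G` and no earlier rows.
    set H : ℤ[X][Y] := ∑ p ∈ Finset.range (D.natDegree + 1),
      D.coeff p • corner b c a₁ a₂ p Q with hH
    have hsmul : ∀ (d : ℤ) (c : ℕ) (a : ℤ) (F : ℤ[X][Y]), RowDvd c a F → RowDvd c a (d • F) :=
      fun d c a F hF q => by rw [coeff_smul]; exact dvd_smul_of_dvd d (hF q)
    have hHmem : laurent b c a₁ a₂ H ∈ clusterAlgebra b c := by
      rw [hH, laurent_sum_smul]
      exact Subring.sum_mem _ fun p _ => Subring.zsmul_mem _ (laurent_corner_mem _ _ _ _ _ _) _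
    have hHrow : RowDvd c a₂ H := RowDvd.sum _ fun p _ => hsmul _ _ _ _ (rowDvd_corner _ _ _ _ _ _)
    have hHcol : RowDvd b a₁ (Bivariate.swap H) := by
      rw [hH, map_sum]
      refine RowDvd.sum _ fun p _ => ?_
      rw [map_zsmul, swap_corner]
      exact hsmul _ _ _ _ (rowDvd_corner _ _ _ _ _ _)
    have h1 : laurent b c a₁ a₂ (G - H) ∈ clusterAlgebra b c := by
      refine ih (Q + 1) (by omega) (G - H) (hrow.sub hHrow)
        (by rw [map_sub]; exact hcol.sub hHcol) fun q hq => ?_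
      rw [coeff_sub, hH, finsetSum_coeff]
      simp only [coeff_smul]
      rcases (show q < Q ∨ q = Q by omega) with h | rfl
      · rw [hzero q h, zero_sub, neg_eq_zero]
        exact Finset.sum_eq_zero fun p _ => by
          rw [coeff_corner_of_lt _ _ _ _ _ _ h, smul_zero]
      · simp only [coeff_corner_self]
        rw [hD]
        conv_lhs => enter [1, 2]; rw [D.as_sum_range]
        rw [Finset.mul_sum, sub_eq_zero]
        refine Finset.sum_congr rfl fun p _ => ?_
        rw [← C_mul_X_pow_eq_monomial, zsmul_eq_mul, ← C_eq_intCast]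
        simp only [Int.cast_id]
        ring
    rw [laurent_sub] at h1
    have := Subring.add_mem _ h1 hHmem
    rwa [sub_add_cancel] at this

/-! ### The change of variables from `x₂` to `x₀`, and divisibility from membership. -/

/-- Changing variables from `x₂` to `x₀`, in a row. -/
theorem zpow_clusterVar_zero_mul (b c : ℕ) (n : ℤ) :
    clusterVar b c 0 ^ (-n) * (1 + x₁ ^ b) ^ n.toNat =
      x₂ ^ n * (1 + x₁ ^ b) ^ (-n).toNat := by
  have h0 := clusterVar_ne_zero b c 0
  have h2 := x₂_ne_zero
  rw [one_add_x₁_pow b c]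
  rcases le_total 0 n with h | h
  · lift n to ℕ using h
    rw [Int.toNat_natCast, Int.toNat_of_nonpos (by omega), pow_zero, mul_one, mul_pow,
      zpow_neg, zpow_natCast, zpow_natCast, inv_mul_cancel_left₀ (pow_ne_zero _ h0)]
  · obtain ⟨k, rfl⟩ : ∃ k : ℕ, n = -(k : ℤ) := ⟨(-n).toNat, by omega⟩
    rw [neg_neg, Int.toNat_natCast, Int.toNat_of_nonpos (by omega), pow_zero, mul_one, mul_pow,
      zpow_neg, zpow_natCast, zpow_natCast, mul_comm (clusterVar b c 0 ^ k),
      inv_mul_cancel_left₀ (pow_ne_zero _ h2)]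

theorem map_evalAt {K L : Type*} [CommRing K] [CommRing L] (σ : K →+* L) (t s : K)
    (G : ℤ[X][Y]) : σ (evalAt t s G) = evalAt (σ t) (σ s) G := by
  have : σ.comp (evalAt t s) = evalAt (σ t) (σ s) := by
    ext <;> simp [evalAt]
  rw [← this]
  rfl

/-- The factor `X ^ k` is coprime to the divisor and can be dropped. The remainder of `f` modulo `(1
+ X) ^ n`, once expanded, is still divisible but of too small a degree, hence zero. -/
theorem one_add_X_pow_dvd_of_expand {f : ℤ[X]} {n b k : ℕ} (hb : 0 < b)
    (h : (1 + X ^ b) ^ n ∣ X ^ k * expand ℤ b f) : (1 + X) ^ n ∣ f := by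
  have h1 : (1 + X ^ b : ℤ[X]) ^ n ∣ expand ℤ b f :=
    (isCoprime_X_pow_one_add_X_pow k n b hb).symm.dvd_of_dvd_mul_left h
  have hmonic : ((1 + X : ℤ[X]) ^ n).Monic := one_add_X_monic.pow n
  have hexp : (1 + X ^ b : ℤ[X]) ^ n = expand ℤ b ((1 + X) ^ n) := by simp
  rw [← modByMonic_eq_zero_iff_dvd hmonic]
  by_contra h0
  set r := f %ₘ (1 + X) ^ n with hr
  have h2 : expand ℤ b ((1 + X) ^ n) ∣ expand ℤ b r := by
    rw [hr, modByMonic_eq_sub_mul_div, map_sub, map_mul, ← hexp]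
    exact dvd_sub h1 (dvd_mul_right _ _)
  refine Monic.not_dvd_of_natDegree_lt ?_ ?_ ?_ h2
  · exact hmonic.expand hb
  · rwa [Ne, expand_eq_zero hb]
  · rw [natDegree_expand, natDegree_expand]
    have h3 : r.natDegree < ((1 + X : ℤ[X]) ^ n).natDegree := by
      refine natDegree_modByMonic_lt _ hmonic fun h4 => ?_
      apply h0
      rw [hr, h4, modByMonic_one]
    gcongr

/-- The rows of an element of the cluster algebra are divisible by powers of `1 + X`. -/
theorem rowDvd_of_mem {b c : ℕ} (hb : 0 < b) (hc : 0 < c) {a₁ a₂ : ℤ} {G : ℤ[X][Y]}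
    (h : laurent b c a₁ a₂ G ∈ clusterAlgebra b c) : RowDvd c a₂ G := by
  intro q₀
  rcases le_or_gt (a₂ - c * q₀) 0 with hle | hlt
  · rw [Int.toNat_of_nonpos hle, pow_zero]; exact one_dvd _
  have ha₂ : 0 < a₂ := by
    have : (0 : ℤ) ≤ c * q₀ := by positivity
    omega
  lift a₂ to ℕ using ha₂.le
  -- Putting `x₀ = (1 + x₁^b)/x₂` for `x₂` makes row `q₀` the coefficient of `x₂^(a₂ - c q₀)`, up to
  -- a power of `x₁`, with denominator `(1 + x₁^b)^(a₂ - c q₀)`. The image is again a Laurent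
  -- polynomial, so the row must cancel this denominator.
  obtain ⟨σ, h1, h2, hσ⟩ := exists_reflection_one (b := b) (c := c)
  obtain ⟨N₀, f₀, hf₀⟩ := exists_mul_pow_eq_evalAt hb hc (map_mem_clusterAlgebra hσ h)
  set d := G.natDegree with hd
  -- `N` is enlarged so that all exponents in `hid` are honest natural numbers.
  obtain ⟨N, f, hf, hN1, hN2⟩ : ∃ (N : ℕ) (f : ℤ[X][Y]),
      σ (laurent b c a₁ a₂ G) * (x₁ * x₂) ^ N = evalAt x₁ x₂ f ∧ a₁ ≤ N ∧ c * d ≤ N := by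
    refine ⟨N₀ + (a₁.toNat + c * d), f₀ * (C X * Y) ^ (a₁.toNat + c * d), ?_, by omega, by omega⟩
    rw [map_mul, map_pow, ← hf₀, pow_add]
    simp [mul_assoc]
  have hx₀ : clusterVar b c 0 = (1 + x₁ ^ b) / x₂ := by
    rw [eq_div_iff x₂_ne_zero, one_add_x₁_pow b c]
  have ht : (1 + x₁ ^ b) ≠ 0 := by
    rw [one_add_x₁_pow b c]; exact mul_ne_zero (clusterVar_ne_zero _ _ _) x₂_ne_zero
  have hid : evalAt x₁ x₂ (∑ q ∈ Finset.range (d + 1),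
      C (X ^ (N - a₁).toNat * (1 + X ^ b) ^ (c * q) * expand ℤ b (G.coeff q)) *
        Y ^ (N + a₂ - c * q)) = evalAt x₁ x₂ (C ((1 + X ^ b) ^ a₂) * f) := by
    have hσG : σ (laurent b c a₁ a₂ G) = x₁ ^ (-a₁) * clusterVar b c 0 ^ (-(a₂ : ℤ)) *
        evalAt (x₁ ^ b) (clusterVar b c 0 ^ c) G := by
      rw [laurent, map_mul, map_mul, map_zpow₀, map_zpow₀, map_evalAt, map_pow, map_pow, h1, h2]
    rw [map_mul, ← hf, hσG, evalAt_eq_sum (N := d + 1) _ _ G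
        (fun q hq => coeff_eq_zero_of_natDegree_lt (by omega)), map_sum, Finset.mul_sum,
      Finset.sum_mul, Finset.mul_sum]
    refine Finset.sum_congr rfl fun q hq => ?_
    have hq' : c * q ≤ N + a₂ := by
      have : c * q ≤ c * d := by gcongr; have := Finset.mem_range.1 hq; omega
      omega
    have e1 : x₁ ^ (-a₁) * x₁ ^ N = x₁ ^ (N - a₁).toNat := by
      rw [← zpow_natCast, ← zpow_natCast, Int.toNat_of_nonneg (by omega), ← zpow_add₀ x₁_ne_zero]
      congr 1; ring
    have e2 : x₂ ^ (N + a₂ - c * q) * x₂ ^ (c * q) = x₂ ^ N * x₂ ^ a₂ := by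
      rw [← pow_add, ← pow_add]; congr 1; omega
    have e3 : eval₂ (Int.castRingHom Ambient) x₁ (expand ℤ b (G.coeff q)) =
        eval₂ (Int.castRingHom Ambient) (x₁ ^ b) (G.coeff q) := by
      rw [expand_eq_comp_X_pow, eval₂_comp]; simp
    simp only [map_mul, map_pow, evalAt_C, evalAt_Y, eval₂_pow, eval₂_add, eval₂_one,
      eval₂_X, e3]
    rw [hx₀, ← e1, zpow_neg _ (a₂ : ℤ), zpow_natCast, ← pow_mul, div_pow, div_pow]
    have hx2 := x₂_ne_zero
    field_simp
    rw [mul_pow]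
    linear_combination (x₁ ^ (-a₁) * x₁ ^ N *
      eval₂ (Int.castRingHom Ambient) (x₁ ^ b) (G.coeff q)) * e2
  have hid' := congrArg (fun g => coeff g (N + a₂ - c * q₀)) (evalAt_injective hid)
  simp only [finsetSum_coeff, coeff_C_mul, coeff_X_pow, mul_ite, mul_one, mul_zero] at hid'
  rcases lt_or_ge d q₀ with hq₀ | hq₀
  · rw [coeff_eq_zero_of_natDegree_lt hq₀]; exact dvd_zero _
  rw [Finset.sum_eq_single q₀, if_pos rfl] at hid'
  · have hsplit : a₂ = c * q₀ + ((a₂ : ℤ) - c * q₀).toNat := by zify; omega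
    generalize ((a₂ : ℤ) - c * q₀).toNat = n at hsplit
    rw [hsplit, pow_add] at hid'
    refine one_add_X_pow_dvd_of_expand hb (k := (N - a₁).toNat) ⟨f.coeff (N + (c * q₀ + n) - c * q₀), ?_⟩
    have hne : (1 + X ^ b : ℤ[X]) ^ (c * q₀) ≠ 0 := by
      have : (1 + X ^ b : ℤ[X]) = expand ℤ b (1 + X) := by simp
      rw [this]
      exact pow_ne_zero _ ((expand_ne_zero hb).2 one_add_X_monic.ne_zero)
    apply mul_left_cancel₀ hne
    linear_combination hid'
  · intro q hq hne
    rw [if_neg]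
    intro heq
    have g1 : c * q ≤ c * d := by gcongr; have := Finset.mem_range.1 hq; omega
    have g2 : c * q₀ ≤ c * d := by gcongr
    exact hne (Nat.eq_of_mul_eq_mul_left hc (by omega))
  · intro h; exact absurd (Finset.mem_range.2 (by omega)) h

end RankTwo

namespace RankTwo

open Polynomial Polynomial.Bivariate

/-! ### Reflection of regional polynomials -/

section Reflect

variable {b c : ℕ} {a₁ a₂ : ℤ} {G : ℤ[X][Y]} {D : ℕ → ℤ[X]}

/-- The polynomial whose rows are those of `G` in reversed order, up to powers of `1 + X`; here `D`
is the family of quotients of the rows of `G`. -/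
noncomputable def reflectPoly (c : ℕ) (a₁ a₂ : ℤ) (D : ℕ → ℤ[X]) : ℤ[X][Y] :=
  ∑ q ∈ Finset.range (a₁.toNat + 1),
    C ((1 + X) ^ (c * a₁ - a₂ - c * q).toNat * D (a₁.toNat - q)) * Y ^ q

theorem coeff_reflectPoly (c : ℕ) (a₁ a₂ : ℤ) (D : ℕ → ℤ[X]) (q : ℕ) :
    (reflectPoly c a₁ a₂ D).coeff q = if q ≤ a₁.toNat then
      (1 + X) ^ (c * a₁ - a₂ - c * q).toNat * D (a₁.toNat - q) else 0 := by
  rw [reflectPoly, finsetSum_coeff]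
  simp only [coeff_C_mul, coeff_X_pow, mul_ite, mul_one, mul_zero, Finset.sum_ite_eq,
    Finset.mem_range, Nat.lt_succ_iff]

/-- Row `r` goes to row `a₁ - r`, where the exponent `a₂ - c r` has become its negative;
`zpow_clusterVar_zero_mul` adjusts the power of `1 + X`, and the quotient is untouched. -/
theorem map_laurent_eq_reflectPoly (ha₁ : 0 ≤ a₁)
    (hD : ∀ q, G.coeff q = (1 + X) ^ (a₂ - c * q).toNat * D q)
    (hG : ∀ q : ℕ, a₁ < q → G.coeff q = 0) (σ : Ambient →+* Ambient) (h₁ : σ x₁ = x₁)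
    (h₂ : σ x₂ = clusterVar b c 0) :
    σ (laurent b c a₁ a₂ G) = laurent b c a₁ (c * a₁ - a₂) (reflectPoly c a₁ a₂ D) := by
  lift a₁ to ℕ using ha₁
  rw [laurent, map_mul, map_mul, map_zpow₀, map_zpow₀, map_evalAt, map_pow, map_pow, h₁, h₂,
    evalAt_eq_sum (N := a₁ + 1) _ _ G (fun q hq => hG q (by omega)), laurent, reflectPoly, map_sum,
    Int.toNat_natCast, Finset.mul_sum, Finset.mul_sum, ← Finset.sum_range_reflect]
  refine Finset.sum_congr rfl fun q hq => ?_
  have hq' : q ≤ a₁ := by have := Finset.mem_range.1 hq; omega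
  obtain ⟨r, rfl⟩ := Nat.exists_eq_add_of_le hq'
  rw [show q + r + 1 - 1 - q = r by omega, show q + r - q = r by omega, hD]
  have hn : (c : ℤ) * ((q + r : ℕ) : ℤ) - a₂ - c * q = -(a₂ - c * r) := by push_cast; ring
  have key := zpow_clusterVar_zero_mul b c (a₂ - c * r)
  rw [zpow_neg_sub_mul (clusterVar_ne_zero b c 0)] at key
  have e1 : x₂ ^ (a₂ - c * r) = x₂ ^ (-((c : ℤ) * ((q + r : ℕ) : ℤ) - a₂)) * (x₂ ^ c) ^ q := by
    rw [← zpow_neg_sub_mul x₂_ne_zero, hn, neg_neg]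
  rw [e1] at key
  rw [hn]
  simp only [map_mul, map_pow, evalAt_C, evalAt_Y, eval₂_mul, eval₂_add, eval₂_pow, eval₂_one, eval₂_X]
  linear_combination (x₁ ^ (-((q + r : ℕ) : ℤ)) *
    eval₂ (Int.castRingHom Ambient) (x₁ ^ b) (D r)) * key

/-- A regional polynomial has no nonconstant coefficient in the first column beyond those of
`(1 + X) ^ a₁`. -/
theorem IsRegional.coeff_swap_zero (h : IsRegional b c a₁ a₂ G) (ha₁ : 0 ≤ a₁) (hc : 0 < c) :
    (Bivariate.swap G).coeff 0 = (1 + X) ^ a₁.toNat := by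
  obtain ⟨E, hE, hE'⟩ := h.col 0
  have h1 := h.coeff_zero
  rw [← coeff_coeff_swap, hE, mul_coeff_zero] at h1
  have h2 : E = 1 := by
    ext q
    rcases Nat.eq_zero_or_pos q with rfl | hq
    · rw [coeff_one_add_X_pow] at h1
      simpa using h1
    · rw [hE' q (by simp; omega) (by simp; positivity), coeff_one, if_neg hq.ne']
  rw [hE, h2]
  simp

/-- Vanishing of the quotients of the rows, in terms of the reflected region. -/
theorem IsRegional.coeff_eq_zero_of_reflect (h : IsRegional b c a₁ a₂ G) (ha₁ : 0 < a₁)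
    (ha₂ : 0 < a₂) (hb : 0 < b) (hc : 0 < c)
    (hD : ∀ q, G.coeff q = (1 + X) ^ (a₂ - c * q).toNat * D q)
    (hD' : ∀ q p : ℕ, (p, q) ≠ (0, 0) → (c : ℤ) * q * a₁ ≤ b * p * a₂ → (D q).coeff p = 0)
    {p q r : ℕ} (hqr : a₁ = q + r) (hpq : (p, q) ≠ (0, 0))
    (hle : (c : ℤ) * q * a₁ ≤ b * p * (c * a₁ - a₂)) : (D r).coeff p = 0 := by
  have hb' : (0 : ℤ) < b := by exact_mod_cast hb
  have hc' : (0 : ℤ) < c := by exact_mod_cast hc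
  have hcr : (c : ℤ) * q = c * a₁ - c * r := by rw [hqr]; ring
  rcases lt_or_ge ((c : ℤ) * r) a₂ with hr | hr
  · -- the row is below the corner
    have hp : p ≠ 0 := by
      rintro rfl
      have : (0 : ℤ) < q := by
        have : q ≠ 0 := by simpa using hpq
        omega
      have : (0 : ℤ) < c * q * a₁ := by positivity
      simp at hle
      linarith
    have hp' : (0 : ℤ) < b * p := by positivity
    have h1 : (c : ℤ) * a₁ - a₂ < c * q := by linarith
    have h2 : (0 : ℤ) ≤ c * q := by positivity
    have h3 : a₁ ≤ b * p := by
      by_contra hlt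
      push Not at hlt
      rcases lt_or_ge 0 ((c : ℤ) * a₁ - a₂) with h | h
      · nlinarith
      · rcases h.lt_or_eq with h' | h'
        · have : (b : ℤ) * p * (c * a₁ - a₂) < 0 := mul_neg_of_pos_of_neg hp' h'
          have : (0 : ℤ) ≤ c * q * a₁ := by positivity
          linarith
        · rw [h', mul_zero] at hle
          have : (0 : ℤ) < c * q * a₁ := by
            apply mul_pos _ ha₁
            linarith
          linarith
    refine hD' r p (by simp [hp]) ?_
    nlinarith
  -- This row carries no power of `1 + X`, so its quotient can also be read off column `p`.
  · have hGr : D r = G.coeff r := by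
      rw [hD r, Int.toNat_of_nonpos (by linarith), pow_zero, one_mul]
    have hr0 : r ≠ 0 := by
      rintro rfl
      simp at hr
      linarith
    rcases le_total ((c : ℤ) * r * a₁) (b * p * a₂) with h1 | h1
    · exact hD' r p (by simp [hr0]) h1
    · obtain ⟨E, hE, hE'⟩ := h.col p
      rw [hGr, ← coeff_coeff_swap, hE]
      rcases le_or_gt a₁ (b * p) with h2 | h2
      · rw [Int.toNat_of_nonpos (by linarith), pow_zero, one_mul]
        exact hE' r (by simp [hr0]) h1
      · rw [coeff_mul]
        refine Finset.sum_eq_zero fun ij hij => ?_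
        obtain ⟨i, j⟩ := ij
        rw [Finset.HasAntidiagonal.mem_antidiagonal] at hij
        simp only at hij ⊢
        rcases lt_or_ge (a₁ - b * p).toNat i with hi | hi
        · rw [coeff_one_add_X_pow, Nat.choose_eq_zero_of_lt hi, Nat.cast_zero, zero_mul]
        -- Since `i ≤ a₁ - b p` and `i + j = r = a₁ - q`, the index `j` is large enough to be in the
        -- region where `E` vanishes.
        · have h3 : (b : ℤ) * p - q ≤ j := by omega
          have hp : p ≠ 0 := by
            rintro rfl
            have : (0 : ℤ) < q := by
              have : q ≠ 0 := by simpa using hpq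
              omega
            have : (0 : ℤ) < c * q * a₁ := by positivity
            simp at hle
            linarith
          rw [hE' j (by simp [hp]) ?_, mul_zero]
          have h4 : (c : ℤ) * (b * p - q) * a₁ ≤ c * j * a₁ := by gcongr
          linarith

/-- The rows are settled by `coeff_eq_zero_of_reflect`. Divisibility of the columns is taken as a
hypothesis, to be supplied by membership in the cluster algebra, so only the support of their
quotients is in question. -/
theorem IsRegional.reflect (h : IsRegional b c a₁ a₂ G) (ha₁ : 0 < a₁) (ha₂ : 0 < a₂)
    (hb : 0 < b) (hc : 0 < c)
    (hD : ∀ q, G.coeff q = (1 + X) ^ (a₂ - c * q).toNat * D q)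
    (hD' : ∀ q p : ℕ, (p, q) ≠ (0, 0) → (c : ℤ) * q * a₁ ≤ b * p * a₂ → (D q).coeff p = 0)
    (hcol : RowDvd b a₁ (Bivariate.swap (reflectPoly c a₁ a₂ D))) :
    IsRegional b c a₁ (c * a₁ - a₂) (reflectPoly c a₁ a₂ D) := by
  have hb' : (0 : ℤ) < b := by exact_mod_cast hb
  have hc' : (0 : ℤ) < c := by exact_mod_cast hc
  -- the first column
  have hcol0 : (Bivariate.swap (reflectPoly c a₁ a₂ D)).coeff 0 = (1 + X) ^ a₁.toNat := by
    ext q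
    rw [coeff_coeff_swap, coeff_reflectPoly]
    split_ifs with hq
    · have h1 := h.coeff_swap_zero ha₁.le hc
      have h2 : (G.coeff (a₁.toNat - q)).coeff 0 = (D (a₁.toNat - q)).coeff 0 := by
        rw [hD, mul_coeff_zero, coeff_one_add_X_pow]; simp
      rw [mul_coeff_zero, ← h2, ← coeff_coeff_swap, h1, coeff_one_add_X_pow, coeff_one_add_X_pow,
        coeff_one_add_X_pow, Nat.choose_symm hq]
      simp
    · rw [Polynomial.coeff_zero, coeff_one_add_X_pow, Nat.choose_eq_zero_of_lt (by omega), Nat.cast_zero]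
  refine ⟨?_, fun q => ?_, fun p => ?_⟩
  · rw [← coeff_coeff_swap, hcol0, coeff_one_add_X_pow]; simp
  · rw [coeff_reflectPoly]
    split_ifs with hq
    · exact ⟨_, rfl, fun p hpq hle =>
        h.coeff_eq_zero_of_reflect ha₁ ha₂ hb hc hD hD' (by omega) hpq hle⟩
    · exact ⟨0, by simp, by simp⟩
  · -- above the corner, the coefficients of a column are those of the quotients of the rows
    have hzero : ∀ q : ℕ, p ≠ 0 → (c : ℤ) * a₁ - a₂ ≤ c * q → c * (a₁ - q) * a₁ ≤ b * p * a₂ →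
        ((Bivariate.swap (reflectPoly c a₁ a₂ D)).coeff p).coeff q = 0 := by
      intro q hp h1 h2
      rw [coeff_coeff_swap, coeff_reflectPoly]
      split_ifs with hq
      · rw [Int.toNat_of_nonpos (by linarith), pow_zero, one_mul]
        refine hD' _ _ (by simp [hp]) ?_
        have : ((a₁.toNat - q : ℕ) : ℤ) = a₁ - q := by omega
        rwa [this]
      · exact Polynomial.coeff_zero _
    obtain ⟨E, hE⟩ := hcol p
    refine ⟨E, hE, fun q hpq hle => ?_⟩
    rcases Nat.eq_zero_or_pos p with rfl | hp
    · have h1 : (1 + X : ℤ[X]) ^ a₁.toNat * 1 = (1 + X) ^ a₁.toNat * E := by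
        rw [Nat.cast_zero, mul_zero, sub_zero, hcol0] at hE
        rw [mul_one, ← hE]
      rw [← mul_left_cancel₀ (one_add_X_pow_ne_zero _) h1, coeff_one, if_neg]
      simpa using hpq
    have hp' : (0 : ℤ) < p := by exact_mod_cast hp
    rcases le_or_gt a₁ (b * p) with hbp | hbp
    · rw [Int.toNat_of_nonpos (by linarith), pow_zero, one_mul] at hE
      rw [← hE]
      refine hzero q hp.ne' ?_ ?_
      · rcases lt_or_ge 0 ((c : ℤ) * a₁ - a₂) with h1 | h1
        · by_contra h2
          push Not at h2
          nlinarith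
        · exact h1.trans (by positivity)
      · have : (0 : ℤ) ≤ (b * p - a₁) * (c * a₁) := mul_nonneg (by linarith) (by positivity)
        linarith
    · rcases le_or_gt q E.natDegree with hq | hq
      -- If `E` has a nonzero coefficient at `q`, its degree is at least `q` and so in the same
      -- region. The leading coefficient of `E` is the coefficient of the column at `m +
      -- E.natDegree`, as the divisor is monic of degree `m`; there `hzero` applies.
      · by_contra hne
        have hE0 : E ≠ 0 := by rintro rfl; simp at hne
        set m := (a₁ - b * p).toNat with hm
        have hm' : (m : ℤ) = a₁ - b * p := by omega
        have hmon : ((1 + X : ℤ[X]) ^ m).Monic := one_add_X_monic.pow m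
        have hdeg : ((1 + X : ℤ[X]) ^ m).natDegree = m := by
          rw [natDegree_pow, add_comm, ← C_1, natDegree_X_add_C, mul_one]
        have hlead := coeff_mul_degree_add_degree ((1 + X : ℤ[X]) ^ m) E
        rw [hmon.leadingCoeff, one_mul, hdeg] at hlead
        rw [← hE] at hlead
        have hd : (b : ℤ) * p * (c * a₁ - a₂) ≤ c * E.natDegree * a₁ := by
          have : (c : ℤ) * q * a₁ ≤ c * E.natDegree * a₁ := by gcongr
          linarith
        refine hE0 (leadingCoeff_eq_zero.1 (hlead.symm.trans (hzero _ hp.ne' ?_ ?_)))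
        · push_cast
          rw [hm']
          by_contra h1
          push Not at h1
          have h2 : (0 : ℤ) ≤ (a₁ - b * p) * a₂ := mul_nonneg (by linarith) ha₂.le
          nlinarith
        · push_cast
          rw [hm']
          linarith
      · exact coeff_eq_zero_of_natDegree_lt hq

end Reflect

end RankTwo

namespace RankTwo

open Polynomial Polynomial.Bivariate

/-! ### Greedy elements -/

section Greedy

variable {b c : ℕ}

theorem exists_isGreedyAt (hb : 0 < b) (hc : 0 < c) (a₁ a₂ : ℤ) :
    ∃ z : clusterAlgebra b c, IsGreedyAt b c a₁ a₂ z := by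
  obtain ⟨G, hG, hpos, -⟩ := exists_isRegional hb hc a₁ a₂
  exact ⟨⟨laurent b c a₁ a₂ G, laurent_mem hc hG.row.rowDvd hG.col.rowDvd⟩,
    hG.isGreedyAt hpos rfl⟩

theorem IsGreedyAt.unique (hb : 0 < b) (hc : 0 < c) {a₁ a₂ : ℤ} {z w : clusterAlgebra b c}
    (hz : IsGreedyAt b c a₁ a₂ z) (hw : IsGreedyAt b c a₁ a₂ w) : z = w := by
  obtain ⟨G, hG, hpos, -⟩ := exists_isRegional hb hc a₁ a₂
  exact Subtype.ext ((hG.eq_laurent_of_isGreedyAt hpos hz).trans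
    (hG.eq_laurent_of_isGreedyAt hpos hw).symm)

theorem isGreedyAt_greedyElement (hb : 0 < b) (hc : 0 < c) (a₁ a₂ : ℤ) :
    IsGreedyAt b c a₁ a₂ (greedyElement b c a₁ a₂) :=
  Classical.epsilon_spec (exists_isGreedyAt hb hc a₁ a₂)

theorem isGreedyAt_iff (hb : 0 < b) (hc : 0 < c) (a₁ a₂ : ℤ) (z : clusterAlgebra b c) :
    IsGreedyAt b c a₁ a₂ z ↔ z = greedyElement b c a₁ a₂ :=
  ⟨fun h => h.unique hb hc (isGreedyAt_greedyElement hb hc a₁ a₂),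
    fun h => h ▸ isGreedyAt_greedyElement hb hc a₁ a₂⟩

/-- The homomorphism of cluster algebras induced by a homomorphism that reverses the order of the
cluster variables. -/
noncomputable def reverseHom {b c b' c' : ℕ} {s : ℤ} (σ : Ambient →+* Ambient)
    (h : ∀ m, σ (clusterVar b c m) = clusterVar b' c' (s - m)) :
    clusterAlgebra b c →+* clusterAlgebra b' c' :=
  σ.restrict _ _ fun _ hz => map_mem_clusterAlgebra h hz

theorem coe_reverseHom {b c b' c' : ℕ} {s : ℤ} (σ : Ambient →+* Ambient)
    (h : ∀ m, σ (clusterVar b c m) = clusterVar b' c' (s - m)) (z : clusterAlgebra b c) :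
    (reverseHom σ h z : Ambient) = σ z := rfl

theorem reverseHom_clusterGen {b c b' c' : ℕ} {s : ℤ} (σ : Ambient →+* Ambient)
    (h : ∀ m, σ (clusterVar b c m) = clusterVar b' c' (s - m)) (m : ℤ) :
    reverseHom σ h (clusterGen b c m) = clusterGen b' c' (s - m) :=
  Subtype.ext (h m)

/-- The cluster variables generate the cluster algebra. -/
theorem clusterAlgebra_hom_ext {R : Type*} [Ring R] {f g : clusterAlgebra b c →+* R}
    (h : ∀ m, f (clusterGen b c m) = g (clusterGen b c m)) : f = g := by
  ext ⟨z, hz⟩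
  induction hz using Subring.closure_induction with
  | mem x hx => obtain ⟨m, rfl⟩ := hx; exact h m
  | zero => exact (map_zero f).trans (map_zero g).symm
  | one => exact (map_one f).trans (map_one g).symm
  | add x y hx hy h1 h2 =>
    have : (⟨x + y, Subring.add_mem _ hx hy⟩ : clusterAlgebra b c) = ⟨x, hx⟩ + ⟨y, hy⟩ := rfl
    rw [this, map_add, map_add, h1, h2]
  | neg x hx h1 =>
    have : (⟨-x, Subring.neg_mem _ hx⟩ : clusterAlgebra b c) = -⟨x, hx⟩ := rfl
    rw [this, map_neg, map_neg, h1]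
  | mul x y hx hy h1 h2 =>
    have : (⟨x * y, Subring.mul_mem _ hx hy⟩ : clusterAlgebra b c) = ⟨x, hx⟩ * ⟨y, hy⟩ := rfl
    rw [this, map_mul, map_mul, h1, h2]

/-- The columns of an element of the cluster algebra are divisible by powers of `1 + X`. -/
theorem colDvd_of_mem (hb : 0 < b) (hc : 0 < c) {a₁ a₂ : ℤ} {G : ℤ[X][Y]}
    (h : laurent b c a₁ a₂ G ∈ clusterAlgebra b c) : RowDvd b a₁ (Bivariate.swap G) := by
  obtain ⟨θ, h1, h2, hθ⟩ := exists_flip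
  refine rowDvd_of_mem (b := c) (a₁ := a₂) hc hb ?_
  have : laurent c b a₂ a₁ (Bivariate.swap G) = θ (laurent b c a₁ a₂ G) := by
    rw [laurent, laurent, map_mul, map_mul, map_zpow₀, map_zpow₀, map_evalAt, map_pow, map_pow,
      h1, h2, evalAt_swap, mul_comm (x₁ ^ (-a₂))]
  rw [this]
  exact map_mem_clusterAlgebra (hθ b c) h

theorem IsGreedyAt.flip (hb : 0 < b) (hc : 0 < c) {a₁ a₂ : ℤ} {z : clusterAlgebra b c}
    (hz : IsGreedyAt b c a₁ a₂ z) {θ : Ambient →+* Ambient} (h₁ : θ x₁ = x₂) (h₂ : θ x₂ = x₁)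
    {w : clusterAlgebra c b} (hw : (w : Ambient) = θ z) : IsGreedyAt c b a₂ a₁ w := by
  obtain ⟨G, hG, hpos, -⟩ := exists_isRegional hb hc a₁ a₂
  refine hG.swap.isGreedyAt hpos.swap ?_
  rw [hw, hG.eq_laurent_of_isGreedyAt hpos hz, laurent, laurent, map_mul, map_mul, map_zpow₀,
    map_zpow₀, map_evalAt, map_pow, map_pow, h₁, h₂, evalAt_swap, mul_comm (x₁ ^ (-a₂))]

/-- The image is regional at the reflected point, and uniqueness identifies its polynomial with the
one already known to be positive there. -/
theorem IsGreedyAt.reflect_of_pos (hb : 0 < b) (hc : 0 < c) {a₁ a₂ : ℤ} (ha₁ : 0 < a₁)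
    (ha₂ : 0 < a₂) {z w : clusterAlgebra b c} (hz : IsGreedyAt b c a₁ a₂ z)
    {σ : Ambient →+* Ambient} (h₁ : σ x₁ = x₁) (h₂ : σ x₂ = clusterVar b c 0)
    (hw : (w : Ambient) = σ z) : IsGreedyAt b c a₁ (c * a₁ - a₂) w := by
  obtain ⟨G, hG, hpos, hbound⟩ := exists_isRegional hb hc a₁ a₂
  rw [max_eq_left ha₁.le] at hbound
  choose D hD hD' using hG.row
  have hlaurent := map_laurent_eq_reflectPoly ha₁.le hD hbound σ h₁ h₂
  rw [← hG.eq_laurent_of_isGreedyAt hpos hz, ← hw] at hlaurent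
  have hreg := hG.reflect ha₁ ha₂ hb hc hD hD'
    (colDvd_of_mem hb hc (by rw [← hlaurent]; exact w.2))
  obtain ⟨G', hG', hpos', -⟩ := exists_isRegional hb hc a₁ (c * a₁ - a₂)
  rw [hreg.unique hG'] at hlaurent
  exact hG'.isGreedyAt hpos' hlaurent

theorem IsGreedyAt.reflect_of_nonpos (hb : 0 < b) {a₁ a₂ : ℤ} (ha₁ : a₁ ≤ 0)
    {z w : clusterAlgebra b c} (hz : IsGreedyAt b c a₁ a₂ z)
    {σ : Ambient →+* Ambient} (h₁ : σ x₁ = x₁) (h₂ : σ x₂ = clusterVar b c 0)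
    (hw : (w : Ambient) = σ z) : IsGreedyAt b c a₁ (-a₂) w := by
  refine (isRegional_of_nonpos hb a₁ (-a₂) ha₁).isGreedyAt (isPositive_of_nonpos b c a₁ _ ha₁) ?_
  rw [hw, (isRegional_of_nonpos hb a₁ a₂ ha₁).eq_laurent_of_isGreedyAt
    (isPositive_of_nonpos b c a₁ a₂ ha₁) hz, laurent, laurent, evalAt_C, evalAt_C,
    eval₂_one_add_X_pow, eval₂_one_add_X_pow, map_mul, map_mul, map_zpow₀, map_zpow₀, map_pow,
    map_add, map_one, map_pow, h₁, h₂, neg_neg, mul_assoc, zpow_clusterVar_zero_mul, mul_assoc]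

/-- The reflection that fixes `x₁` maps greedy elements to greedy elements. -/
theorem IsGreedyAt.reflect (hb : 0 < b) (hc : 0 < c) {a₁ a₂ : ℤ}
    {z : clusterAlgebra b c} (hz : IsGreedyAt b c a₁ a₂ z)
    {ρ : clusterAlgebra b c →+* clusterAlgebra b c} (hρ : Function.Involutive ρ)
    {σ : Ambient →+* Ambient} (h₁ : σ x₁ = x₁) (h₂ : σ x₂ = clusterVar b c 0)
    (hw : ∀ z, (ρ z : Ambient) = σ z) :
    IsGreedyAt b c a₁ (c * max a₁ 0 - a₂) (ρ z) := by
  rcases le_or_gt a₁ 0 with ha₁ | ha₁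
  · rw [max_eq_right ha₁, mul_zero, zero_sub]
    exact hz.reflect_of_nonpos hb ha₁ h₁ h₂ (hw z)
  rw [max_eq_left ha₁.le]
  rcases lt_or_ge 0 a₂ with ha₂ | ha₂
  · exact hz.reflect_of_pos hb hc ha₁ ha₂ h₁ h₂ (hw z)
  -- For `a₂ ≤ 0 < a₁` the reflected point has both coordinates positive, so the reflection is
  -- carried out from there and inverted.
  obtain ⟨w, hw'⟩ := exists_isGreedyAt hb hc a₁ (c * a₁ - a₂)
  have hpos : (0 : ℤ) < c * a₁ - a₂ := by
    have : (0 : ℤ) < c * a₁ := by positivity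
    linarith
  have h := hw'.reflect_of_pos hb hc ha₁ hpos h₁ h₂ (hw w)
  rw [sub_sub_cancel] at h
  rw [hz.unique hb hc h, hρ w]
  exact hw'

end Greedy

/-! ### The automorphisms of the cluster algebra. -/

/-- The two reflections that generate all the automorphisms `σ_p`. -/
theorem exists_reflections {b c : ℕ} (hb : 0 < b) (hc : 0 < c) :
    ∃ ρ₁ ρ₂ : RingAut (clusterAlgebra b c),
      (∀ m, ρ₁ (clusterGen b c m) = clusterGen b c (2 - m)) ∧
      (∀ m, ρ₂ (clusterGen b c m) = clusterGen b c (4 - m)) ∧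
      (∀ a₁ a₂ z, IsGreedyAt b c a₁ a₂ z →
        IsGreedyAt b c a₁ (c * max a₁ 0 - a₂) (ρ₁ z)) ∧
      (∀ a₁ a₂ z, IsGreedyAt b c a₁ a₂ z →
        IsGreedyAt b c (b * max a₂ 0 - a₁) a₂ (ρ₂ z)) := by
  have hinv : ∀ {b c : ℕ} (s : ℤ) (ρ : clusterAlgebra b c →+* clusterAlgebra b c),
      (∀ m, ρ (clusterGen b c m) = clusterGen b c (s - m)) → Function.Involutive ρ := by
    intro b c s ρ h z
    have : ρ.comp ρ = RingHom.id _ := clusterAlgebra_hom_ext fun m => by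
      simp [h]
    exact DFunLike.congr_fun this z
  obtain ⟨σ, h1, h2, hσ⟩ := exists_reflection_one (b := b) (c := c)
  obtain ⟨σ', h1', h2', hσ'⟩ := exists_reflection_one (b := c) (c := b)
  obtain ⟨θ, g1, g2, hθ⟩ := exists_flip
  set f := reverseHom σ hσ with hf
  set f' := reverseHom σ' hσ' with hf'
  set t := reverseHom θ (hθ b c)
  set t' := reverseHom θ (hθ c b)
  have hfi := hinv 2 f (reverseHom_clusterGen σ hσ)
  have hfi' := hinv 2 f' (reverseHom_clusterGen σ' hσ')
  -- The second reflection is the first one for `(c, b)` conjugated by the flip: `m ↦ 3 - m ↦ m - 1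
  -- ↦ 4 - m`.
  have hg : ∀ m, (t'.comp (f'.comp t)) (clusterGen b c m) = clusterGen b c (4 - m) := by
    intro m
    simp only [RingHom.comp_apply, t, t', hf', reverseHom_clusterGen]
    congr 1
    ring
  have hgi := hinv 4 (t'.comp (f'.comp t)) hg
  refine ⟨RingEquiv.ofBijective f hfi.bijective, RingEquiv.ofBijective _ hgi.bijective,
    reverseHom_clusterGen σ hσ, hg, fun a₁ a₂ z hz => ?_, fun a₁ a₂ z hz => ?_⟩
  · exact hz.reflect hb hc hfi h1 h2 (coe_reverseHom _ _)
  · have e1 : IsGreedyAt c b a₂ a₁ (t z) := hz.flip hb hc g1 g2 (coe_reverseHom _ _ _)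
    have e2 := e1.reflect hc hb hfi' h1' h2' (coe_reverseHom _ _)
    exact e2.flip hc hb g1 g2 (coe_reverseHom θ (hθ c b) (f' (t z)))

end RankTwo

theorem proposition1p8 (b c : ℕ) (hb : 0 < b) (hc : 0 < c) :
    -- `x[a₁, a₂]` is well defined: it is the one and only greedy element at `(a₁, a₂)`
    (∀ (a₁ a₂ : ℤ) (z : RankTwo.clusterAlgebra b c),
      RankTwo.IsGreedyAt b c a₁ a₂ z ↔ z = RankTwo.greedyElement b c a₁ a₂) ∧
    -- the automorphisms `σ_p` (unique, because the `x_m` generate the cluster algebra)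
    ∃ σ : ℤ → (RankTwo.clusterAlgebra b c ≃+* RankTwo.clusterAlgebra b c),
      (∀ p m : ℤ, σ p (RankTwo.clusterGen b c m) = RankTwo.clusterGen b c (2 * p - m)) ∧
      (∀ p : ℤ, Function.Involutive (σ p)) ∧
      (∀ p : ℤ, σ p '' RankTwo.greedyBasis b c = RankTwo.greedyBasis b c) ∧
      (∀ a₁ a₂ : ℤ,
        σ 1 (RankTwo.greedyElement b c a₁ a₂) =
          RankTwo.greedyElement b c a₁ ((c : ℤ) * max a₁ 0 - a₂)) ∧
      (∀ a₁ a₂ : ℤ,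
        σ 2 (RankTwo.greedyElement b c a₁ a₂) =
          RankTwo.greedyElement b c ((b : ℤ) * max a₂ 0 - a₁) a₂) := by
  refine ⟨RankTwo.isGreedyAt_iff hb hc, ?_⟩
  obtain ⟨ρ₁, ρ₂, h1, h2, hg1, hg2⟩ := RankTwo.exists_reflections hb hc
  have hinv : ∀ (s : ℤ) (ρ : RingAut (RankTwo.clusterAlgebra b c)),
      (∀ m, ρ (RankTwo.clusterGen b c m) = RankTwo.clusterGen b c (s - m)) →
        Function.Involutive ρ := by
    intro s ρ h z
    have : (ρ * ρ : RingAut (RankTwo.clusterAlgebra b c)).toRingHom = RingHom.id _ :=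
      RankTwo.clusterAlgebra_hom_ext fun m => by
        change ρ (ρ _) = _
        simp [h]
    exact DFunLike.congr_fun this z
  have hi1 := hinv 2 ρ₁ h1
  have hi2 := hinv 4 ρ₂ h2
  -- `T` shifts indices by `2`, so `T ^ (p - 1) * ρ₁` sends `m` to `2 p - m`.
  set T : RingAut (RankTwo.clusterAlgebra b c) := ρ₂ * ρ₁ with hT
  have hTapply : ∀ z, T z = ρ₂ (ρ₁ z) := fun z => rfl
  have hTinv : ∀ z, T⁻¹ z = ρ₁ (ρ₂ z) := fun z => by
    change T.symm z = _
    rw [RingEquiv.symm_apply_eq, hTapply, hi1, hi2]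
  have hTgen : ∀ k m : ℤ, (T ^ k) (RankTwo.clusterGen b c m) =
      RankTwo.clusterGen b c (m + 2 * k) := by
    intro k
    induction k using Int.induction_on with
    | zero => intro m; simp
    | succ k ih =>
      intro m
      rw [zpow_add_one, RingAut.mul_apply, hTapply, h1, h2, ih]
      congr 1
      ring
    | pred k ih =>
      intro m
      rw [zpow_sub_one, RingAut.mul_apply, hTinv, h2, h1, ih]
      congr 1
      ring
  have hbasis1 : ∀ z ∈ RankTwo.greedyBasis b c, ρ₁ z ∈ RankTwo.greedyBasis b c := by
    rintro z ⟨a₁, a₂, hz⟩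
    exact ⟨_, _, hg1 _ _ _ hz⟩
  have hbasis2 : ∀ z ∈ RankTwo.greedyBasis b c, ρ₂ z ∈ RankTwo.greedyBasis b c := by
    rintro z ⟨a₁, a₂, hz⟩
    exact ⟨_, _, hg2 _ _ _ hz⟩
  have hTbasis : ∀ k : ℤ, ∀ z ∈ RankTwo.greedyBasis b c, (T ^ k) z ∈ RankTwo.greedyBasis b c := by
    intro k
    induction k using Int.induction_on with
    | zero => intro z hz; simpa using hz
    | succ k ih =>
      intro z hz
      rw [zpow_add_one, RingAut.mul_apply, hTapply]
      exact ih _ (hbasis2 _ (hbasis1 _ hz))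
    | pred k ih =>
      intro z hz
      rw [zpow_sub_one, RingAut.mul_apply, hTinv]
      exact ih _ (hbasis1 _ (hbasis2 _ hz))
  have hσgen : ∀ p m : ℤ, (T ^ (p - 1) * ρ₁) (RankTwo.clusterGen b c m) =
      RankTwo.clusterGen b c (2 * p - m) := fun p m => by
    rw [RingAut.mul_apply, h1, hTgen]
    congr 1
    ring
  have hσinv : ∀ p : ℤ, Function.Involutive (T ^ (p - 1) * ρ₁) := fun p =>
    hinv _ _ (hσgen p)
  refine ⟨fun p => T ^ (p - 1) * ρ₁, hσgen, hσinv, fun p => ?_, fun a₁ a₂ => ?_, fun a₁ a₂ => ?_⟩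
  · have hsub : ∀ z ∈ RankTwo.greedyBasis b c,
        (T ^ (p - 1) * ρ₁) z ∈ RankTwo.greedyBasis b c := fun z hz =>
      hTbasis _ _ (hbasis1 z hz)
    refine Set.Subset.antisymm (Set.image_subset_iff.2 hsub) fun z hz => ?_
    exact ⟨_, hsub z hz, hσinv p z⟩
  · rw [← RankTwo.isGreedyAt_iff hb hc]
    simp only [sub_self, zpow_zero, one_mul]
    exact hg1 _ _ _ (RankTwo.isGreedyAt_greedyElement hb hc a₁ a₂)
  · rw [← RankTwo.isGreedyAt_iff hb hc]
    have : (T ^ ((2 : ℤ) - 1) * ρ₁) (RankTwo.greedyElement b c a₁ a₂) =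
        ρ₂ (RankTwo.greedyElement b c a₁ a₂) := by
      rw [show (2 : ℤ) - 1 = 1 by norm_num, zpow_one, RingAut.mul_apply, hTapply, hi1]
    rw [this]
    exact hg2 _ _ _ (RankTwo.isGreedyAt_greedyElement hb hc a₁ a₂)
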